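/- A function $f:\mathbb N\to\mathbb N$ is of subexponential growth if for every $\delta>0$ there is $C_\delta>0$ with $f(n)\le C_\delta(1+\delta)^n$ for all $n\ge 1$. Let $f$ be such a function and let $G$ be an infinite connected graph with $|B_r(x)|\le f(r)$ for all $x\in V(G)$, $r\ge1$, where $B_r(x)$ is the ball of radius $r$ around $x$. A Følner sequence in $G$ is a sequence $\{F_n\}_{n\ge1}$ of finite nonempty induced subgraphs with $\bigcup_n F_n=G$ and $|\partial F_n|/|V(F_n)|\to0$, where $\partial F_n$ is the set of vertices of $F_n$ that have a $G$-neighbour outside $F_n$. Assume that $G$ has uniform patch frequency: every Følner sequence $\{F_n\}$ in $G$ is weakly convergent, i.e. $|V(F_n)|\to\infty$ and for every $r\ge1$ and every finite rooted graph $\alpha$ of radius at most $r$ the proportion of vertices of $F_n$ whose rooted $r$-ball in $F_n$ is isomorphic to $\alpha$ converges as $n\to\infty$. Let $X$ be a random variable taking finitely many real values, and let $\omega=(\omega(x))_{x\in V(G)}$ be independent random variables distributed as $X$, i.e. $\omega$ is distributed according to the product measure. For a finite induced subgraph $F$ of $G$ let $(\Delta^\omega_F h)(x)=\deg_F(x)h(x)-\sum_{(x,y)\in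 E(F)}h(y)+\omega(x)h(x)$ on $\ell^2(V(F))$, and let $N_{\Delta_F^\omega}(\lambda)$ be the number of eigenvalues of $\Delta_F^\omega$ not greater than $\lambda$, counted with multiplicities, divided by $|V(F)|$. Then there is a function $N_G^X:\mathbb R\to\mathbb R$ (the integrated density of states), not depending on $\omega$, such that the following holds for every Følner sequence $\{G_n\}$ in $G$ for which the number of different subgraphs with exactly $k$ vertices among the $G_n$ is a function of $k$ of subexponential growth (for instance if $G_1\subseteq G_2\subseteq\cdots$, or if $|V(G_n)|/\log n\to\infty$): for almost every $\omega$, the functions $N_{\Delta^\omega_{G_n}}$ converge to $N_G^X$ uniformly on $\mathbb R$. -/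

import Mathlib

open Filter Topology MeasureTheory

/-- A function `f : ℕ → ℕ` is of subexponential growth. -/
def IsSubexponential (f : ℕ → ℕ) : Prop :=
  ∀ δ : ℝ, 0 < δ → ∃ C : ℝ, 0 < C ∧ ∀ n : ℕ, 1 ≤ n → (f n : ℝ) ≤ C * (1 + δ) ^ n

namespace SimpleGraph

/-- The vertex set of the closed ball `B_r(x)`. -/
def closedBall {W : Type*} (K : SimpleGraph W) (x : W) (r : ℕ) : Set W :=
  {y | K.edist x y ≤ (r : ℕ∞)}

/-- The rooted graph `(H, o)` is a rooted `r`-ball: every vertex is at distance at most `r` from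
the root `o` (in particular `H` is connected). -/
def IsRootedBall {A : Type*} (H : SimpleGraph A) (o : A) (r : ℕ) : Prop :=
  ∀ y : A, H.edist o y ≤ (r : ℕ∞)

/-- The set of those vertices `x` of `K` for which the rooted ball `B_r(x)` (an induced subgraph
of `K` with root `x`) is isomorphic, as a rooted graph, to `(H, o)`. -/
def patchSet {W A : Type*} (K : SimpleGraph W) (H : SimpleGraph A) (o : A) (r : ℕ) : Set W :=
  {x | ∃ e : H ≃g K.induce (K.closedBall x r), (e o : W) = x}

/-- The proportion of the vertices of the finite graph `K` whose rooted `r`-ball is isomorphic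
to `(H, o)`. -/
noncomputable def patchFrequency {W A : Type*} (K : SimpleGraph W) (H : SimpleGraph A) (o : A)
    (r : ℕ) : ℝ :=
  ((K.patchSet H o r).ncard : ℝ) / (Nat.card W : ℝ)

/-- Weak (Benjamini-Schramm) convergence of a sequence of finite graphs: the orders tend to
infinity and the frequency of each rooted ball converges. Every finite rooted graph is isomorphic
to one on some `Fin m`. If the degrees in all `K n` are at most `d`, then balls with a vertex of
degree larger than `d` have frequency `0` throughout. -/
def WeaklyConvergent {W : ℕ → Type*} (K : ∀ n, SimpleGraph (W n)) : Prop :=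
  Tendsto (fun n => Nat.card (W n)) atTop atTop ∧
  ∀ r : ℕ, 1 ≤ r → ∀ (m : ℕ) (H : SimpleGraph (Fin m)) (o : Fin m), H.IsRootedBall o r →
    ∃ c : ℝ, Tendsto (fun n => (K n).patchFrequency H o r) atTop (𝓝 c)

/-- The (inner) boundary of a finite vertex set. -/
def innerBoundary {V : Type*} (G : SimpleGraph V) (F : Finset V) : Set V :=
  {p | p ∈ F ∧ ∃ q, q ∉ F ∧ G.Adj p q}

/-- A sequence of finite nonempty vertex sets, standing for the subgraphs of `G` they induce, is a
Følner sequence: the union of the induced subgraphs is `G`, and `|∂F n| / |F n| → 0`. -/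
def IsFolnerSequence {V : Type*} (G : SimpleGraph V) (F : ℕ → Finset V) : Prop :=
  (∀ n, (F n).Nonempty) ∧
  (⨆ n, (⊤ : G.Subgraph).induce (F n : Set V)) = ⊤ ∧
  Tendsto (fun n => ((G.innerBoundary (F n)).ncard : ℝ) / ((F n).card : ℝ)) atTop (𝓝 0)

/-- Uniform patch frequency: every Følner sequence of induced subgraphs is weakly convergent. -/
def HasUniformPatchFrequency {V : Type*} (G : SimpleGraph V) : Prop :=
  ∀ F : ℕ → Finset V, G.IsFolnerSequence F →
    WeaklyConvergent (fun n => G.induce {x : V | x ∈ F n})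

open Classical in
/-- The matrix of the Schrödinger operator `f ↦ Δ_K f + ω f` on the finite graph `K`, where
`(Δ_K f) x = deg x * f x - ∑_{y ∼ x} f y`. -/
noncomputable def schrodinger {W : Type*} [Fintype W] (K : SimpleGraph W) (ω : W → ℝ) :
    Matrix W W ℝ :=
  K.lapMatrix ℝ + Matrix.diagonal ω

theorem isHermitian_schrodinger {W : Type*} [Fintype W] (K : SimpleGraph W) (ω : W → ℝ) :
    (K.schrodinger ω).IsHermitian := by
  classical
  unfold schrodinger
  refine Matrix.IsHermitian.add ?_ ?_
  · exact K.isHermitian_lapMatrix ℝ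
  · exact Matrix.isHermitian_diagonal_iff.mpr (fun _ => IsSelfAdjoint.all _)

open Classical in
/-- The normalized spectral distribution function of a real symmetric matrix: the number of
eigenvalues not greater than `t`, counted with multiplicities, divided by the dimension. -/
noncomputable def _root_.Matrix.IsHermitian.spectralDistribution {W : Type*} [Fintype W]
    {A : Matrix W W ℝ} (hA : A.IsHermitian) (t : ℝ) : ℝ :=
  (Nat.card {i : W // hA.eigenvalues i ≤ t} : ℝ) / (Fintype.card W : ℝ)

/-- The normalized spectral distribution function of the Schrödinger operator with potential `ω`
(restricted to `F`) on the subgraph of `G` induced by the finite vertex set `F`. -/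
noncomputable def schrodingerDistribution {V : Type*} (G : SimpleGraph V) (F : Finset V)
    (ω : V → ℝ) (t : ℝ) : ℝ :=
  ((G.induce {x : V | x ∈ F}).isHermitian_schrodinger
    (fun x => ω (x : V))).spectralDistribution t

end SimpleGraph

/-- The law of a family, indexed by `V`, of independent random variables with values in the finite
set `R` of reals and with common distribution `p`: the product measure on `V → R`. -/
noncomputable def iidPotential (V : Type*) {R : Finset ℝ} (p : PMF R) : Measure (V → R) :=
  Measure.infinitePi (fun _ : V => p.toMeasure)

/-! Subexponential growth makes finite pieces of `G` uniformly hyperfinite: deleting an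
`ε`-proportion of the vertices leaves blocks of size bounded in terms of `ε`
(`exists_small_separator`). The compressed operator is block diagonal with blocks from a finite list
of matrices, so its eigenvalues lie in a finite set `S` that depends neither on the piece nor on the
potential. By Cauchy interlacing, every distribution function then grows by at most `ε` across an
interval that avoids `S` (`exists_finite_jumps`). Hence convergence at countably many points is
already uniform (`exists_finite_net`), and the indicator of `(-∞, t]` may be replaced by a
polynomial (`exists_polynomial_approx`).

Expectations converge because the mean diagonal entry of the `k`-th power at a vertex depends only
on the isomorphism type of a ball around it, so weak convergence applies to mean traces of
polynomials. Interleaving two Følner sequences shows that the limit is common to all of them.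

Fluctuations vanish because changing the potential at one vertex moves the eigenvalue count by at
most one. The bounded differences inequality bounds the probability of a deviation `ε` by `2
exp(-ε²|F|/2)`, which is summable over subexponentially many sets of each size, and Borel–Cantelli
concludes. -/

namespace Matrix

/-! ### Orthonormal frames and Cauchy interlacing. -/

theorem dotProduct_mulVec_self_of_frame {m s : Type*} [Fintype m] [Fintype s] [DecidableEq s]
    {X : Matrix m s ℝ} (hX : Xᵀ * X = 1) (c : s → ℝ) : (X *ᵥ c) ⬝ᵥ (X *ᵥ c) = c ⬝ᵥ c := by
  rw [dotProduct_mulVec, vecMul_mulVec, hX, vecMul_one]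

theorem form_mulVec_of_frame {m s : Type*} [Fintype m] [Fintype s] [DecidableEq s]
    {A : Matrix m m ℝ} {X : Matrix m s ℝ} {a : s → ℝ} (hX : Xᵀ * A * X = diagonal a) (c : s → ℝ) :
    (X *ᵥ c) ⬝ᵥ (A *ᵥ (X *ᵥ c)) = ∑ i, a i * (c i * c i) := by
  have : (X *ᵥ c) ⬝ᵥ (A *ᵥ (X *ᵥ c)) = c ⬝ᵥ ((Xᵀ * A * X) *ᵥ c) := by
    rw [← mulVec_mulVec, ← mulVec_mulVec, dotProduct_mulVec c, vecMul_transpose]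
  rw [this, hX, dotProduct]
  refine Finset.sum_congr rfl fun i _ => ?_
  rw [mulVec_diagonal]; ring

/-- A subspace on which the form of `A` is at most `t` and one on which it is larger than `t`
(both given by orthonormal frames diagonalizing the form) are independent. -/
theorem card_add_card_le_of_frames {m s s' : Type*} [Fintype m] [Fintype s] [Fintype s']
    [DecidableEq s] [DecidableEq s']
    (A : Matrix m m ℝ) (X : Matrix m s ℝ) (Y : Matrix m s' ℝ) (a : s → ℝ) (b : s' → ℝ) (t : ℝ)
    (hX : Xᵀ * X = 1) (hY : Yᵀ * Y = 1) (hXA : Xᵀ * A * X = diagonal a)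
    (hYA : Yᵀ * A * Y = diagonal b) (ha : ∀ i, a i ≤ t) (hb : ∀ i, t < b i) :
    Fintype.card s + Fintype.card s' ≤ Fintype.card m := by
  -- A common vector `u = X c = Y d` has form at most `t |u|²` by `X`, and strictly more by `Y`
  -- unless `d = 0`.
  have hinj : Function.Injective (X.mulVecLin.coprod (-Y.mulVecLin)) := by
    rw [injective_iff_map_eq_zero]
    rintro ⟨c, d⟩ h
    simp only [LinearMap.coprod_apply, LinearMap.neg_apply, mulVecLin_apply] at h
    have h : X *ᵥ c = Y *ᵥ d := by rwa [← sub_eq_add_neg, sub_eq_zero] at h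
    have h1 : c ⬝ᵥ c = d ⬝ᵥ d := by rw [← dotProduct_mulVec_self_of_frame hX, h, dotProduct_mulVec_self_of_frame hY]
    have h2 : ∑ i, a i * (c i * c i) = ∑ i, b i * (d i * d i) := by
      rw [← form_mulVec_of_frame hXA, h, form_mulVec_of_frame hYA]
    have h3 : ∑ i, a i * (c i * c i) ≤ t * (c ⬝ᵥ c) := by
      rw [dotProduct, Finset.mul_sum]
      exact Finset.sum_le_sum fun i _ => mul_le_mul_of_nonneg_right (ha i) (mul_self_nonneg _)
    have h4 : ∑ i, (b i - t) * (d i * d i) ≤ 0 := by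
      simp only [sub_mul, Finset.sum_sub_distrib, ← Finset.mul_sum]
      rw [← h2]
      have : ∑ i, d i * d i = c ⬝ᵥ c := h1.symm
      rw [this]; linarith
    have h5 : ∀ i ∈ Finset.univ, 0 ≤ (b i - t) * (d i * d i) := fun i _ =>
      mul_nonneg (sub_nonneg.2 (hb i).le) (mul_self_nonneg _)
    have h6 := (Finset.sum_eq_zero_iff_of_nonneg h5).1 (le_antisymm h4 (Finset.sum_nonneg h5))
    have hd : d = 0 := by
      funext i
      have := h6 i (Finset.mem_univ _)
      simpa [sub_ne_zero.2 (hb i).ne'] using this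
    have hc : c = 0 := by
      rw [hd, dotProduct_zero] at h1
      exact dotProduct_self_eq_zero.1 h1
    rw [hc, hd]; rfl
  simpa using LinearMap.finrank_le_finrank_of_injective hinj

namespace IsHermitian

open Classical in
/-- The number of eigenvalues not greater than `t`, counted with multiplicities. -/
noncomputable def eigenvalueCount {m : Type*} [Fintype m] {A : Matrix m m ℝ}
    (hA : A.IsHermitian) (t : ℝ) : ℕ :=
  Nat.card {i : m // hA.eigenvalues i ≤ t}

theorem spectralDistribution_eq {m : Type*} [Fintype m] {A : Matrix m m ℝ}
    (hA : A.IsHermitian) (t : ℝ) :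
    hA.spectralDistribution t = (hA.eigenvalueCount t : ℝ) / Fintype.card m := rfl

open Classical in
theorem exists_frame {m : Type*} [Fintype m] {A : Matrix m m ℝ} (hA : A.IsHermitian)
    (P : m → Prop) :
    ∃ X : Matrix m {i // P i} ℝ, Xᵀ * X = 1 ∧
      Xᵀ * A * X = diagonal (fun i : {i // P i} => hA.eigenvalues i) := by
  have hU : (hA.eigenvectorUnitary : Matrix m m ℝ)ᵀ * (hA.eigenvectorUnitary : Matrix m m ℝ) = 1 :=
    (Matrix.mem_unitaryGroup_iff'.1 hA.eigenvectorUnitary.2)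
  have hUA : (hA.eigenvectorUnitary : Matrix m m ℝ)ᵀ * A * (hA.eigenvectorUnitary : Matrix m m ℝ) =
      diagonal hA.eigenvalues := by
    have := hA.conjStarAlgAut_star_eigenvectorUnitary
    rw [Unitary.conjStarAlgAut_star_apply] at this
    exact this
  set U := (hA.eigenvectorUnitary : Matrix m m ℝ)
  let e : {i // P i} → m := Subtype.val
  have he : Function.Injective e := Subtype.val_injective
  refine ⟨U.submatrix id e, ?_, ?_⟩
  · have : (U.submatrix id e)ᵀ * U.submatrix id e = (Uᵀ * U).submatrix e e := by
      ext i j; simp [Matrix.mul_apply]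
    rw [this, hU, submatrix_one _ he]
  · have : (U.submatrix id e)ᵀ * A * U.submatrix id e = (Uᵀ * A * U).submatrix e e := by
      ext i j; simp [Matrix.mul_apply]
    rw [this, hUA, submatrix_diagonal _ _ he]
    rfl

open Classical in
theorem card_gt {m : Type*} [Fintype m] {A : Matrix m m ℝ} (hA : A.IsHermitian) (t : ℝ) :
    hA.eigenvalueCount t + Fintype.card {i // t < hA.eigenvalues i} = Fintype.card m := by
  have h := Fintype.card_subtype_compl (fun i => hA.eigenvalues i ≤ t)
  have h' := Fintype.card_subtype_le (fun i => hA.eigenvalues i ≤ t)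
  simp only [not_le] at h
  rw [eigenvalueCount, Nat.card_eq_fintype_card, h]
  omega

theorem eigenvalueCount_mono {m : Type*} [Fintype m] {A : Matrix m m ℝ} (hA : A.IsHermitian)
    {s t : ℝ} (h : s ≤ t) : hA.eigenvalueCount s ≤ hA.eigenvalueCount t := by
  classical
  exact Nat.card_mono (Set.toFinite {i | hA.eigenvalues i ≤ t}) fun _ hi => le_trans hi h

/-- Extension by zero along `J` is isometric and compresses `A` to its principal submatrix, so test
spaces for the submatrix are test spaces for `A`. -/
theorem submatrix_frame {m n s : Type*} [Fintype m] [Fintype n] [Fintype s] [DecidableEq s]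
    {A : Matrix m m ℝ} {J : n → m} (hJ : Function.Injective J) {X : Matrix n s ℝ} {a : s → ℝ} (h1 : Xᵀ * X = 1)
    (h2 : Xᵀ * A.submatrix J J * X = diagonal a) :
    ∃ Y : Matrix m s ℝ, Yᵀ * Y = 1 ∧ Yᵀ * A * Y = diagonal a := by
  classical
  have e1 : ((1 : Matrix m m ℝ).submatrix id J)ᵀ * (1 : Matrix m m ℝ).submatrix id J = 1 := by
    have : ((1 : Matrix m m ℝ).submatrix id J)ᵀ * (1 : Matrix m m ℝ).submatrix id J =
      ((1 : Matrix m m ℝ)ᵀ * 1).submatrix J J := by ext i j; simp [Matrix.mul_apply, Matrix.one_apply]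
    rw [this]; simp [submatrix_one _ hJ]
  have e2 : ((1 : Matrix m m ℝ).submatrix id J)ᵀ * A * (1 : Matrix m m ℝ).submatrix id J =
      A.submatrix J J := by
    have : ((1 : Matrix m m ℝ).submatrix id J)ᵀ * A * (1 : Matrix m m ℝ).submatrix id J =
      ((1 : Matrix m m ℝ)ᵀ * A * 1).submatrix J J := by ext i j; simp [Matrix.mul_apply, Matrix.one_apply]
    rw [this]; simp
  refine ⟨(1 : Matrix m m ℝ).submatrix id J * X, ?_, ?_⟩
  · rw [transpose_mul, Matrix.mul_assoc, ← Matrix.mul_assoc _ _ X, e1, Matrix.one_mul, h1]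
  · rw [transpose_mul, ← h2, ← e2]; simp only [Matrix.mul_assoc]

/-- Cauchy interlacing, lower bound. -/
theorem eigenvalueCount_submatrix_le {m n : Type*} [Fintype m] [Fintype n] {A : Matrix m m ℝ}
    (hA : A.IsHermitian) {J : n → m} (hJ : Function.Injective J)
    (hB : (A.submatrix J J).IsHermitian) (t : ℝ) :
    hB.eigenvalueCount t ≤ hA.eigenvalueCount t := by
  classical
  obtain ⟨X, h1, h2⟩ := hB.exists_frame (fun i => hB.eigenvalues i ≤ t)
  obtain ⟨X', h1', h2'⟩ := submatrix_frame hJ h1 h2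
  obtain ⟨Y, h3, h4⟩ := hA.exists_frame (fun i => t < hA.eigenvalues i)
  -- Low eigenvectors of the submatrix are independent of high eigenvectors of `A`.
  have := card_add_card_le_of_frames A X' Y _ _ t h1' h3 h2' h4 (fun i => i.2) (fun i => i.2)
  rw [← hA.card_gt t, ← Nat.card_eq_fintype_card] at this
  exact Nat.le_of_add_le_add_right this

/-- Cauchy interlacing, upper bound. -/
theorem eigenvalueCount_le_submatrix {m n : Type*} [Fintype m] [Fintype n] {A : Matrix m m ℝ}
    (hA : A.IsHermitian) {J : n → m} (hJ : Function.Injective J)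
    (hB : (A.submatrix J J).IsHermitian) (t : ℝ) :
    hA.eigenvalueCount t + Fintype.card n ≤ hB.eigenvalueCount t + Fintype.card m := by
  classical
  obtain ⟨X, h1, h2⟩ := hB.exists_frame (fun i => t < hB.eigenvalues i)
  obtain ⟨X', h1', h2'⟩ := submatrix_frame hJ h1 h2
  obtain ⟨Y, h3, h4⟩ := hA.exists_frame (fun i => hA.eigenvalues i ≤ t)
  have := card_add_card_le_of_frames A Y X' _ _ t h3 h1' h4 h2' (fun i => i.2) (fun i => i.2)
  rw [← hB.card_gt t]
  rw [← Nat.card_eq_fintype_card (α := {i // hA.eigenvalues i ≤ t})] at this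
  change hA.eigenvalueCount t + _ ≤ _ at this
  omega

open Classical in
theorem trace_pow_eq_sum {m : Type*} [Fintype m] {A : Matrix m m ℝ} (hA : A.IsHermitian) (k : ℕ) :
    (A ^ k).trace = ∑ i, hA.eigenvalues i ^ k := by
  conv_lhs => rw [hA.spectral_theorem, ← map_pow, Unitary.conjStarAlgAut_apply,
    Matrix.trace_mul_comm, ← Matrix.mul_assoc]
  simp [diagonal_pow, trace_diagonal]

end IsHermitian

end Matrix

/-! ### Subexponential growth and hyperfiniteness. -/

theorem IsSubexponential.exists_lt_pow {f : ℕ → ℕ} (hf : IsSubexponential f) {ε : ℝ} (hε : 0 < ε) :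
    ∃ T : ℕ, 1 ≤ T ∧ (f T : ℝ) < (1 + ε) ^ T := by
  obtain ⟨C, hC, h⟩ := hf (ε / 2) (by positivity)
  have hlim : Tendsto (fun n : ℕ => C * ((1 + ε / 2) / (1 + ε)) ^ n) atTop (𝓝 (C * 0)) :=
    (tendsto_pow_atTop_nhds_zero_of_lt_one (by positivity)
      ((div_lt_one (by positivity)).2 (by linarith))).const_mul C
  rw [mul_zero] at hlim
  obtain ⟨T, hT, hT1⟩ := ((hlim.eventually (gt_mem_nhds one_pos)).and (eventually_ge_atTop 1)).exists
  refine ⟨T, hT1, (h T hT1).trans_lt ?_⟩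
  rw [div_pow, ← mul_div_assoc, div_lt_one (by positivity)] at hT
  exact hT

namespace SimpleGraph

open Classical in
/-- The ball of radius `r` around `x` in the subgraph induced on `insert x F`. -/
noncomputable def finsetBall {V : Type*} (G : SimpleGraph V) (F : Finset V) (x : V) :
    ℕ → Finset V
  | 0 => {x}
  | r + 1 => G.finsetBall F x r ∪ F.filter (fun y => ∃ z ∈ G.finsetBall F x r, G.Adj z y)

theorem finsetBall_subset_succ {V : Type*} (G : SimpleGraph V) (F : Finset V) (x : V) (r : ℕ) :
    G.finsetBall F x r ⊆ G.finsetBall F x (r + 1) := by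
  classical exact Finset.subset_union_left

theorem finsetBall_mono {V : Type*} (G : SimpleGraph V) (F : Finset V) (x : V) :
    Monotone (G.finsetBall F x) :=
  monotone_nat_of_le_succ (G.finsetBall_subset_succ F x)

theorem finsetBall_subset {V : Type*} (G : SimpleGraph V) {F : Finset V} {x : V} (hx : x ∈ F)
    (r : ℕ) : G.finsetBall F x r ⊆ F := by
  classical
  induction r with
  | zero => simpa [finsetBall] using hx
  | succ r ih => exact Finset.union_subset ih (Finset.filter_subset _ _)

theorem finsetBall_subset_closedBall {V : Type*} (G : SimpleGraph V) (F : Finset V) (x : V)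
    (r : ℕ) : (G.finsetBall F x r : Set V) ⊆ G.closedBall x r := by
  classical
  induction r with
  | zero => simp [finsetBall, closedBall]
  | succ r ih =>
    intro y hy
    rw [finsetBall, Finset.coe_union] at hy
    rcases hy with hy | hy
    · exact le_trans (show G.edist x y ≤ r from ih hy) (by exact_mod_cast Nat.le_succ r)
    · obtain ⟨z, hz, hzy⟩ := (Finset.mem_filter.1 hy).2
      have h1 : G.edist x z ≤ r := ih hz
      have h2 : G.edist z y ≤ 1 := (edist_eq_one_iff_adj.2 hzy).le
      exact G.edist_triangle.trans ((add_le_add h1 h2).trans (by simp))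

theorem card_finsetBall_le {V : Type*} {G : SimpleGraph V} {f : ℕ → ℕ}
    (hball : ∀ (x : V) (r : ℕ), 1 ≤ r → (G.closedBall x r).encard ≤ (f r : ℕ∞))
    (F : Finset V) (x : V) {r : ℕ} (hr : 1 ≤ r) : (G.finsetBall F x r).card ≤ f r := by
  have := (Set.encard_le_encard (G.finsetBall_subset_closedBall F x r)).trans (hball x r hr)
  rw [Set.encard_coe_eq_coe_finsetCard] at this
  exact_mod_cast this

/-- Finite subgraphs of a graph of subexponential growth are uniformly hyperfinite: removing a
small proportion of the vertices leaves pieces of bounded size. -/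
theorem exists_small_separator {V : Type*} {G : SimpleGraph V} {f : ℕ → ℕ}
    (hf : IsSubexponential f)
    (hball : ∀ (x : V) (r : ℕ), 1 ≤ r → (G.closedBall x r).encard ≤ (f r : ℕ∞))
    {ε : ℝ} (hε : 0 < ε) :
    ∃ M : ℕ, ∀ F : Finset V, ∃ U ⊆ F, (F.card : ℝ) ≤ U.card + ε * F.card ∧
      ∃ c : V → ℕ, (∀ x ∈ U, ∀ y ∈ U, G.Adj x y → c x = c y) ∧
        ∀ k, (U.filter (fun x => c x = k)).card ≤ M := by
  classical
  obtain ⟨T, hT1, hT⟩ := hf.exists_lt_pow hε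
  refine ⟨f T, fun F => ?_⟩
  induction F using Finset.strongInduction with
  | H F ih =>
  rcases F.eq_empty_or_nonempty with rfl | ⟨x, hx⟩
  · exact ⟨∅, subset_rfl, by simp, fun _ => 0, by simp, by simp⟩
  set B := G.finsetBall F x with hB
  -- Growth by a factor above `1 + ε` at each of `T` steps would give a `T`-ball with more than `f
  -- T` vertices. The ball `B r` becomes a block, the sphere `B (r + 1) \ B r` is discarded at cost
  -- `ε |B r|`, and the rest is treated by induction.
  obtain ⟨r, hrT, hr⟩ : ∃ r < T, ((B (r + 1)).card : ℝ) ≤ (1 + ε) * (B r).card := by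
    by_contra! hcon
    have : ∀ r ≤ T, (1 + ε) ^ r ≤ ((B r).card : ℝ) := by
      intro r
      induction r with
      | zero => simp [hB, finsetBall]
      | succ r ihr =>
        intro hr
        rw [pow_succ']
        exact (mul_le_mul_of_nonneg_left (ihr (by omega)) (by positivity)).trans
          (hcon r (by omega)).le
    have h2 : ((B T).card : ℝ) ≤ f T := by exact_mod_cast card_finsetBall_le hball F x hT1
    linarith [this T le_rfl]
  have hBF : B (r + 1) ⊆ F := G.finsetBall_subset hx _
  have hBB : B r ⊆ B (r + 1) := G.finsetBall_subset_succ F x r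
  have hxB : x ∈ B (r + 1) :=
    G.finsetBall_mono F x (Nat.zero_le (r + 1)) (by simp [finsetBall])
  obtain ⟨U, hUF, hcard, c, hc, hcM⟩ := ih (F \ B (r + 1))
    (Finset.sdiff_ssubset hBF ⟨x, hxB⟩)
  have hdisj : Disjoint (B r) U := by
    refine Finset.disjoint_left.2 fun y hy hyU => ?_
    exact (Finset.mem_sdiff.1 (hUF hyU)).2 (hBB hy)
  have hUB : ∀ y ∈ U, y ∉ B r := fun y hy hy' => Finset.disjoint_left.1 hdisj hy' hy
  have hedge : ∀ y ∈ B r, ∀ z ∈ U, ¬ G.Adj y z := by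
    intro y hy z hz hyz
    have hz' := Finset.mem_sdiff.1 (hUF hz)
    exact hz'.2 (Finset.mem_union_right _ (Finset.mem_filter.2 ⟨hz'.1, y, hy, hyz⟩))
  refine ⟨B r ∪ U, Finset.union_subset (hBB.trans hBF) (hUF.trans Finset.sdiff_subset), ?_,
    -- The shift of the old labels frees label `0` for the new block.
    fun y => if y ∈ B r then 0 else c y + 1, ?_, ?_⟩
  · rw [Finset.card_union_of_disjoint hdisj]
    have h1 := Finset.card_sdiff_add_card_eq_card hBF
    have h1' : ((F \ B (r + 1)).card : ℝ) + (B (r + 1)).card = F.card := by exact_mod_cast h1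
    have h2 : ((B r).card : ℝ) ≤ (B (r + 1)).card := by exact_mod_cast Finset.card_le_card hBB
    push_cast
    rw [← h1', mul_add]
    have := mul_le_mul_of_nonneg_left h2 hε.le
    linarith
  · intro y hy z hz hyz
    rcases Finset.mem_union.1 hy with hy | hy <;> rcases Finset.mem_union.1 hz with hz | hz
    · simp [hy, hz]
    · exact absurd hyz (hedge y hy z hz)
    · exact absurd hyz.symm (hedge z hz y hy)
    · simp [hUB y hy, hUB z hz, hc y hy z hz hyz]
  · intro k
    rcases k with _ | k
    · refine (Finset.card_le_card (t := B T) ?_).trans (card_finsetBall_le hball F x hT1)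
      intro y hy
      have h := (Finset.mem_filter.1 hy).2
      have : y ∈ B r := by by_contra h'; simp [h'] at h
      exact G.finsetBall_mono F x hrT.le this
    · refine (Finset.card_le_card ?_).trans (hcM k)
      intro y hy
      obtain ⟨hy1, h⟩ := Finset.mem_filter.1 hy
      have hyB : y ∉ B r := by intro h'; simp [h'] at h
      simp only [hyB, if_false, Nat.add_right_cancel_iff] at h
      exact Finset.mem_filter.2 ⟨(Finset.mem_union.1 hy1).resolve_left hyB, h⟩

end SimpleGraph

/-! ### Spectra of matrices with bounded blocks. -/

namespace Matrix

/-- The eigenvalues of the matrices of order at most `M` with entries in `E`. -/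
def boundedSpectrum (E : Set ℝ) (M : ℕ) : Set ℝ :=
  {t | ∃ m ≤ M, ∃ B : Matrix (Fin m) (Fin m) ℝ, (∀ i j, B i j ∈ E) ∧
    ∃ v : Fin m → ℝ, v ≠ 0 ∧ B *ᵥ v = t • v}

theorem finite_boundedSpectrum {E : Set ℝ} (hE : E.Finite) (M : ℕ) :
    (boundedSpectrum E M).Finite := by
  have : boundedSpectrum E M = ⋃ m ∈ Set.Iic M, ⋃ B ∈ {B : Matrix (Fin m) (Fin m) ℝ |
      ∀ i j, B i j ∈ E}, {t | ∃ v : Fin m → ℝ, v ≠ 0 ∧ B *ᵥ v = t • v} := by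
    ext t; simp [boundedSpectrum]
  rw [this]
  refine (Set.finite_Iic M).biUnion fun m _ => Set.Finite.biUnion ?_ fun B _ => ?_
  · have : {B : Matrix (Fin m) (Fin m) ℝ | ∀ i j, B i j ∈ E} =
        Set.pi Set.univ fun _ => Set.pi Set.univ fun _ => E := by
      ext B
      exact ⟨fun h i _ j _ => h i j, fun h i j => h i trivial j trivial⟩
    rw [this]
    exact Set.Finite.pi fun _ => Set.Finite.pi fun _ => hE
  · refine (Module.End.finite_hasEigenvalue (Matrix.toLin' B)).subset ?_
    rintro t ⟨v, hv, h⟩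
    exact Module.End.hasEigenvalue_of_hasEigenvector
      (x := v) ⟨Module.End.mem_eigenspace_iff.2 (by simpa using h), hv⟩

/-- The eigenvalues of a block diagonal matrix are eigenvalues of its blocks. -/
theorem mem_boundedSpectrum_of_blocks {E : Set ℝ} {M : ℕ} {m : Type*} [Fintype m]
    {A : Matrix m m ℝ} (hA : ∀ i j, A i j ∈ E) (c : m → ℕ) (hc : ∀ i j, c i ≠ c j → A i j = 0)
    (hM : ∀ k, Nat.card {i // c i = k} ≤ M) {t : ℝ} {v : m → ℝ} (hv : v ≠ 0)
    (h : A *ᵥ v = t • v) : t ∈ boundedSpectrum E M := by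
  classical
  -- The eigenvector restricted to the block of a nonzero coordinate is an eigenvector of that
  -- block.
  obtain ⟨i₀, hi₀⟩ := Function.ne_iff.1 hv
  have e : Fin (Nat.card {i // c i = c i₀}) ≃ {i // c i = c i₀} :=
    (Finite.equivFin _).symm
  refine ⟨_, hM (c i₀), A.submatrix (fun i => (e i : m)) (fun i => (e i : m)),
    fun _ _ => hA _ _, fun i => v (e i), ?_, ?_⟩
  · refine Function.ne_iff.2 ⟨e.symm ⟨i₀, rfl⟩, ?_⟩
    simpa using hi₀
  · funext j
    have h1 := congrFun h (e j)
    simp only [mulVec, dotProduct, Pi.smul_apply, submatrix_apply] at h1 ⊢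
    rw [← h1, e.sum_comp (fun i => A (e j) i * v i)]
    rw [← Finset.sum_subtype (Finset.univ.filter (fun i => c i = c i₀)) (by simp)
      (fun i => A (e j) i * v i), Finset.sum_filter]
    refine Finset.sum_congr rfl fun i _ => ?_
    split_ifs with hi
    · rfl
    · rw [hc _ _ (fun h' => hi (h'.symm.trans (e j).2)), zero_mul]

end Matrix

/-! ### Jumps of the distribution functions and their dependence on the potential. -/

namespace SimpleGraph

open Classical in
theorem schrodinger_apply {W : Type*} [Fintype W] (K : SimpleGraph W) (ω : W → ℝ) (i j : W) :
    K.schrodinger ω i j =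
      if i = j then (K.degree i : ℝ) + ω i else if K.Adj i j then -1 else 0 := by
  rw [schrodinger, Matrix.add_apply, lapMatrix, Matrix.sub_apply, degMatrix, adjMatrix_apply]
  by_cases h : i = j
  · subst h; simp
  · by_cases h' : K.Adj i j <;> simp [h, h']

open Classical in
theorem degree_induce_le {V : Type*} {G : SimpleGraph V} {d : ℕ}
    (hd : ∀ x : V, (G.closedBall x 1).encard ≤ (d : ℕ∞)) (F : Finset V)
    (x : {x : V | x ∈ F}) : (G.induce {x : V | x ∈ F}).degree x ≤ d := by
  have h1 : ((((G.induce {x : V | x ∈ F}).neighborFinset x).map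
      ⟨Subtype.val, Subtype.val_injective⟩ : Finset V) : Set V) ⊆ G.closedBall x 1 := by
    intro y hy
    obtain ⟨z, hz, rfl⟩ := Finset.mem_map.1 (Finset.mem_coe.1 hy)
    rw [mem_neighborFinset] at hz
    exact (edist_eq_one_iff_adj.2 (show G.Adj x z from hz)).le
  have h2 := (Set.encard_le_encard h1).trans (hd x)
  rw [Set.encard_coe_eq_coe_finsetCard, Finset.card_map] at h2
  exact_mod_cast h2

/-- The possible entries of Schrödinger matrices with degrees at most `d` and potential in `R`. -/
def schrodingerEntries (d : ℕ) (R : Finset ℝ) : Set ℝ :=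
  {0, -1} ∪ Set.image2 (fun (j : ℕ) (r : ℝ) => (j : ℝ) + r) (Set.Iic d) R

theorem finite_schrodingerEntries (d : ℕ) (R : Finset ℝ) : (schrodingerEntries d R).Finite :=
  (Set.toFinite _).union ((Set.finite_Iic d).image2 _ R.finite_toSet)

open Classical in
theorem schrodinger_mem_entries {W : Type*} [Fintype W] {K : SimpleGraph W} {d : ℕ}
    (hd : ∀ x, K.degree x ≤ d) {R : Finset ℝ} {ω : W → ℝ} (hω : ∀ x, ω x ∈ R) (i j : W) :
    K.schrodinger ω i j ∈ schrodingerEntries d R := by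
  rw [schrodinger_apply]
  split_ifs
  · exact Or.inr ⟨_, hd i, _, hω i, rfl⟩
  · exact Or.inl (by simp)
  · exact Or.inl (by simp)

theorem card_setOf_mem {V : Type*} (F : Finset V) : Fintype.card {x : V | x ∈ F} = F.card := by
  simp

/-- Up to an error `ε`, the spectral distribution functions of all finite induced subgraphs and all
potentials can only jump at finitely many points. -/
theorem exists_finite_jumps {V : Type*} {G : SimpleGraph V} {f : ℕ → ℕ}
    (hf : IsSubexponential f)
    (hball : ∀ (x : V) (r : ℕ), 1 ≤ r → (G.closedBall x r).encard ≤ (f r : ℕ∞))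
    (R : Finset ℝ) {ε : ℝ} (hε : 0 < ε) :
    ∃ S : Set ℝ, S.Finite ∧ ∀ (F : Finset V) (ω : V → ℝ), (∀ v, ω v ∈ R) →
      ∀ s s' : ℝ, (∀ t ∈ S, t ≤ s ∨ s' < t) →
        G.schrodingerDistribution F ω s' ≤ G.schrodingerDistribution F ω s + ε := by
  classical
  obtain ⟨M, hM⟩ := exists_small_separator hf hball hε
  refine ⟨Matrix.boundedSpectrum (schrodingerEntries (f 1) R) M,
    Matrix.finite_boundedSpectrum (finite_schrodingerEntries _ _) M, fun F ω hω s s' hs => ?_⟩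
  obtain ⟨U, hUF, hcard, c, hc, hcM⟩ := hM F
  rw [schrodingerDistribution, schrodingerDistribution,
    Matrix.IsHermitian.spectralDistribution_eq, Matrix.IsHermitian.spectralDistribution_eq,
    card_setOf_mem]
  rcases F.eq_empty_or_nonempty with rfl | hF
  · simpa using hε.le
  have hFpos : (0 : ℝ) < F.card := by exact_mod_cast hF.card_pos
  set hA := (G.induce {x : V | x ∈ F}).isHermitian_schrodinger (fun x => ω (x : V))
  set A := (G.induce {x : V | x ∈ F}).schrodinger (fun x => ω (x : V)) with hAdef
  -- The compression keeps the degrees computed in `F` on its diagonal; these are still at most `f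
  -- 1`, so the list of possible blocks is finite.
  let J : U → {x : V | x ∈ F} := fun x => ⟨x, hUF x.2⟩
  have hJ : Function.Injective J := fun x y h => Subtype.ext (Subtype.mk.inj h)
  have hB : (A.submatrix J J).IsHermitian := hA.submatrix J
  have hspec : ∀ i, hB.eigenvalues i ∈
      Matrix.boundedSpectrum (schrodingerEntries (f 1) R) M := by
    intro i
    refine Matrix.mem_boundedSpectrum_of_blocks (A := A.submatrix J J) ?_ (fun x : U => c x) ?_ ?_
      (v := ⇑(hB.eigenvectorBasis i)) ?_ (hB.mulVec_eigenvectorBasis i)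
    · exact fun i j => schrodinger_mem_entries
        (degree_induce_le (fun x => hball x 1 le_rfl) F) (fun x => hω x) _ _
    · intro x y hxy
      have hne : x ≠ y := fun h => hxy (by rw [h])
      rw [Matrix.submatrix_apply, hAdef, schrodinger_apply, if_neg (hJ.ne hne), if_neg]
      exact fun h => hxy (hc x x.2 y y.2 h)
    · intro k
      refine le_trans (le_of_eq ?_) (hcM k)
      rw [Nat.card_eq_fintype_card, Fintype.card_subtype]
      refine Finset.card_bij (fun x _ => x.1) ?_ ?_ ?_
      · intro x hx; simpa using hx
      · intro x _ y _ h; exact Subtype.ext h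
      · intro x hx
        have hx := Finset.mem_filter.1 hx
        exact ⟨⟨x, hx.1⟩, by simpa using hx.2, rfl⟩
    · intro h
      exact hB.eigenvectorBasis.orthonormal.ne_zero i ((WithLp.ofLp_eq_zero 2).1 h)
  have h1 : hB.eigenvalueCount s' ≤ hB.eigenvalueCount s := by
    refine Nat.card_mono (Set.toFinite {i | hB.eigenvalues i ≤ s}) fun i hi => ?_
    exact (hs _ (hspec i)).resolve_right (not_lt.2 hi)
  -- Passing to `U` and back costs at most `|F| - |U| ≤ ε |F|` eigenvalues, and the compression has
  -- none in `(s, s']`.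
  have h2 := hA.eigenvalueCount_submatrix_le hJ hB s
  have h3 := hA.eigenvalueCount_le_submatrix hJ hB s'
  rw [card_setOf_mem, Fintype.card_coe] at h3
  have h4 : ((hA.eigenvalueCount s' : ℝ) + U.card) ≤ hA.eigenvalueCount s + F.card := by
    exact_mod_cast h3.trans (Nat.add_le_add_right (h1.trans h2) _)
  rw [← sub_le_iff_le_add', ← sub_div, div_le_iff₀ hFpos]
  linarith

theorem schrodingerDistribution_mono {V : Type*} (G : SimpleGraph V) (F : Finset V) (ω : V → ℝ) :
    Monotone (G.schrodingerDistribution F ω) := by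
  intro s t h
  rw [schrodingerDistribution, schrodingerDistribution,
    Matrix.IsHermitian.spectralDistribution_eq, Matrix.IsHermitian.spectralDistribution_eq]
  have := Matrix.IsHermitian.eigenvalueCount_mono
    ((G.induce {x : V | x ∈ F}).isHermitian_schrodinger (fun x => ω (x : V))) h
  gcongr

/-- Changing the potential at a single vertex changes the spectral distribution function by at most
the inverse of the number of vertices. -/
theorem card_mul_schrodingerDistribution_le {V : Type*} (G : SimpleGraph V) (F : Finset V)
    {ω ω' : V → ℝ} {v : V} (hv : ∀ x ∈ F, x ≠ v → ω x = ω' x) (t : ℝ) :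
    F.card * G.schrodingerDistribution F ω t ≤ F.card * G.schrodingerDistribution F ω' t + 1 := by
  classical
  rcases F.eq_empty_or_nonempty with rfl | hF
  · simp
  have hFpos : (F.card : ℝ) ≠ 0 := by exact_mod_cast hF.card_pos.ne'
  rw [schrodingerDistribution, schrodingerDistribution,
    Matrix.IsHermitian.spectralDistribution_eq, Matrix.IsHermitian.spectralDistribution_eq,
    card_setOf_mem, mul_div_cancel₀ _ hFpos, mul_div_cancel₀ _ hFpos]
  set hA := (G.induce {x : V | x ∈ F}).isHermitian_schrodinger (fun x => ω (x : V))
  set hA' := (G.induce {x : V | x ∈ F}).isHermitian_schrodinger (fun x => ω' (x : V))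
  -- Both operators interlace with the same principal submatrix, obtained by deleting `v`.
  let J : ↥(F.erase v) → {x : V | x ∈ F} := fun x => ⟨x, Finset.mem_of_mem_erase x.2⟩
  have hJ : Function.Injective J := fun x y h => Subtype.ext (Subtype.mk.inj h)
  have heq : ((G.induce {x : V | x ∈ F}).schrodinger (fun x => ω' (x : V))).submatrix J J =
      ((G.induce {x : V | x ∈ F}).schrodinger (fun x => ω (x : V))).submatrix J J := by
    ext i j
    simp only [Matrix.submatrix_apply, schrodinger_apply]
    rw [hv (J i) (J i).2 (Finset.ne_of_mem_erase i.2)]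
  have hB := hA.submatrix J
  have hB' := hA'.submatrix J
  have h1 := hA.eigenvalueCount_le_submatrix hJ hB t
  have h2 := hA'.eigenvalueCount_submatrix_le hJ hB' t
  have h3 : hB'.eigenvalueCount t = hB.eigenvalueCount t := by
    congr 1
  rw [card_setOf_mem, Fintype.card_coe] at h1
  have h4 := Finset.pred_card_le_card_erase (s := F) (a := v)
  have : hA.eigenvalueCount t ≤ hA'.eigenvalueCount t + 1 := by omega
  exact_mod_cast this

end SimpleGraph

/-! ### Concentration for bounded differences. -/

namespace ProbabilityTheory

/-- McDiarmid's bounded differences inequality (with a non-optimal constant) for functions of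
finitely many independent, identically distributed variables with finitely many values. -/
theorem hasSubgaussianMGF_pi_of_bounded_differences {α : Type*} [Finite α] [MeasurableSpace α]
    [MeasurableSingletonClass α] (P : Measure α) [IsProbabilityMeasure P] (n : ℕ)
    (h : (Fin n → α) → ℝ) (hh : ∀ c c' i, (∀ j ≠ i, c j = c' j) → h c ≤ h c' + 1) :
    HasSubgaussianMGF (fun c => h c - ∫ c, h c ∂(Measure.pi fun _ => P)) n
      (Measure.pi fun _ : Fin n => P) := by
  refine ⟨fun t => Integrable.of_finite, fun t => ?_⟩
  induction n with
  | zero =>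
    have h1 : ∀ c, h c = h default := fun c => congrArg h (Subsingleton.elim _ _)
    simp [mgf, h1]
  | succ n ih =>
    have hmp := (measurePreserving_piFinSuccAbove (fun _ : Fin (n + 1) => P) 0).symm
    set e := (MeasurableEquiv.piFinSuccAbove (fun _ : Fin (n + 1) => α) 0).symm with he
    have hint : ∀ g : (Fin (n + 1) → α) → ℝ, ∫ c, g c ∂(Measure.pi fun _ => P) =
        ∫ c, ∫ a, g (e (a, c)) ∂P ∂(Measure.pi fun _ : Fin n => P) := by
      intro g
      rw [← hmp.integral_comp e.measurableEmbedding g, integral_prod_symm _ Integrable.of_finite]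
    have hcons : ∀ a c, e (a, c) = Fin.cons a c := by
      intro a c
      simp only [he, MeasurableEquiv.piFinSuccAbove, Fin.insertNthEquiv_zero]
      rfl
    have hupd : ∀ a b c, h (e (b, c)) ≤ h (e (a, c)) + 1 := by
      intro a b c
      refine hh _ _ 0 fun j hj => ?_
      obtain ⟨j, rfl⟩ := Fin.exists_succ_eq.2 hj
      simp [hcons]
    have hupd' : ∀ a c c' i, (∀ j ≠ i, c j = c' j) → h (e (a, c)) ≤ h (e (a, c')) + 1 := by
      intro a c c' i hc
      refine hh _ _ i.succ fun j hj => ?_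
      rcases Fin.eq_zero_or_eq_succ j with rfl | ⟨j, rfl⟩
      · simp [hcons]
      · simpa [hcons] using hc j (fun h => hj (h ▸ rfl))
    -- Averaging out the first coordinate preserves bounded differences, so induction controls `H -
    -- E H`; Hoeffding's lemma controls `h - H` conditionally on the other coordinates.
    set H : (Fin n → α) → ℝ := fun c => ∫ a, h (e (a, c)) ∂P with hH
    have hH1 : ∀ c c' i, (∀ j ≠ i, c j = c' j) → H c ≤ H c' + 1 := by
      intro c c' i hc
      have : H c' + 1 = ∫ a, (h (e (a, c')) + 1) ∂P := by
        rw [integral_add Integrable.of_finite Integrable.of_finite]; simp [hH]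
      rw [this]
      exact integral_mono Integrable.of_finite Integrable.of_finite fun a => hupd' a c c' i hc
    have hE : ∫ c, h c ∂(Measure.pi fun _ => P) = ∫ c, H c ∂(Measure.pi fun _ => P) := hint h
    have hinner : ∀ c, ∫ a, Real.exp (t * (h (e (a, c)) - H c)) ∂P ≤ Real.exp (t ^ 2 / 2) := by
      intro c
      obtain ⟨a₀⟩ : Nonempty α := P.nonempty_of_neZero
      -- An interval of length `2` has variance proxy `(2 / 2)² = 1`, so each coordinate adds `1` to
      -- the proxy.
      have hb : ∀ᵐ a ∂P, h (e (a, c)) ∈ Set.Icc (h (e (a₀, c)) - 1) (h (e (a₀, c)) + 1) :=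
        Eventually.of_forall fun a => ⟨by linarith [hupd a a₀ c], hupd a₀ a c⟩
      have h1 := (hasSubgaussianMGF_of_mem_Icc (Measurable.of_discrete).aemeasurable hb).mgf_le t
      refine h1.trans_eq ?_
      have : h (e (a₀, c)) + 1 - (h (e (a₀, c)) - 1) = 2 := by ring
      rw [this]
      norm_num
    have hsplit : ∀ c a, Real.exp (t * (h (e (a, c)) - ∫ c, h c ∂(Measure.pi fun _ => P))) =
        Real.exp (t * (H c - ∫ c, H c ∂(Measure.pi fun _ => P))) *
          Real.exp (t * (h (e (a, c)) - H c)) := by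
      intro c a
      rw [← Real.exp_add, hE]; ring_nf
    rw [mgf, hint]
    simp only [hsplit, integral_const_mul]
    calc _ ≤ ∫ c, Real.exp (t * (H c - ∫ c, H c ∂(Measure.pi fun _ => P))) *
          Real.exp (t ^ 2 / 2) ∂(Measure.pi fun _ : Fin n => P) :=
        integral_mono Integrable.of_finite Integrable.of_finite fun c =>
          mul_le_mul_of_nonneg_left (hinner c) (Real.exp_nonneg _)
      _ ≤ Real.exp (n * t ^ 2 / 2) * Real.exp (t ^ 2 / 2) := by
        rw [integral_mul_const]
        exact mul_le_mul_of_nonneg_right (by simpa [mgf] using ih H hH1) (Real.exp_nonneg _)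
      _ = _ := by
        rw [← Real.exp_add]; push_cast; ring_nf

end ProbabilityTheory

open ProbabilityTheory

/-! ### Product measures and functions of finitely many coordinates. -/

section iid

variable {V : Type*} {R : Finset ℝ} (p : PMF R)

instance : IsProbabilityMeasure (iidPotential V p) := by
  unfold iidPotential; infer_instance

/-- The preimage of a cylinder over `s` is the cylinder over `ι(s)` with the same factors. This is
what makes expectations on a ball depend only on its isomorphism type. -/
theorem iidPotential_map_comp {A : Type*} {ι : A → V} (hι : Function.Injective ι) :
    (iidPotential V p).map (fun ω a => ω (ι a)) = iidPotential A p := by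
  classical
  refine Measure.eq_infinitePi _ fun s t ht => ?_
  have hm : Measurable (fun (ω : V → R) (a : A) => ω (ι a)) := by fun_prop
  rw [Measure.map_apply hm (MeasurableSet.pi s.countable_toSet fun i _ => ht i)]
  have : (fun (ω : V → R) (a : A) => ω (ι a)) ⁻¹' Set.pi s t =
      Set.pi (s.map ⟨ι, hι⟩ : Finset V)
        (fun v => if h : ∃ a, ι a = v then t h.choose else Set.univ) := by
    ext ω
    simp only [Set.mem_preimage, Set.mem_pi, Finset.coe_map, Set.mem_image,
      forall_exists_index, and_imp, Function.Embedding.coeFn_mk]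
    constructor
    · rintro h _ a ha rfl
      have hex : ∃ b, ι b = ι a := ⟨a, rfl⟩
      rw [dif_pos hex, hι hex.choose_spec]
      exact h a ha
    · intro h a ha
      have hex : ∃ b, ι b = ι a := ⟨a, rfl⟩
      have := h _ a ha rfl
      rw [dif_pos hex] at this
      rwa [hι hex.choose_spec] at this
  rw [this, iidPotential, Measure.infinitePi_pi, Finset.prod_map]
  · refine Finset.prod_congr rfl fun a _ => ?_
    have hex : ∃ b, ι b = ι a := ⟨a, rfl⟩
    simp only [Function.Embedding.coeFn_mk]
    rw [dif_pos hex, hι hex.choose_spec]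
  · intro v _
    split_ifs
    · exact ht _
    · exact MeasurableSet.univ

theorem integral_iidPotential_comp {A : Type*} [Finite A] {ι : A → V} (hι : Function.Injective ι)
    (g : (A → R) → ℝ) :
    ∫ ω, g (fun a => ω (ι a)) ∂(iidPotential V p) = ∫ c, g c ∂(iidPotential A p) := by
  have hm : Measurable (fun (ω : V → R) (a : A) => ω (ι a)) := by fun_prop
  rw [← iidPotential_map_comp p hι,
    integral_map hm.aemeasurable (Measurable.of_discrete).aestronglyMeasurable]

/-- A function of the potential at the vertices of `F` factors through a function on
`Fin F.card → R`. -/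
theorem exists_factor_of_dependsOn {F : Finset V} {g : (V → R) → ℝ} (hg : DependsOn g F)
    (ω₀ : V → R) : ∃ (ι : Fin F.card → V) (h : (Fin F.card → R) → ℝ), Function.Injective ι ∧
      (∀ i, ι i ∈ F) ∧ (∀ ω, g ω = h (fun i => ω (ι i))) ∧
      ∀ c c' i, (∀ j ≠ i, c j = c' j) →
        ∃ ω ω' v, (∀ x ≠ v, ω x = ω' x) ∧ h c = g ω ∧ h c' = g ω' := by
  classical
  let e := F.equivFin
  let ext : (Fin F.card → R) → V → R := fun c v => if h : v ∈ F then c (e ⟨v, h⟩) else ω₀ v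
  refine ⟨fun i => e.symm i, fun c => g (ext c),
    Subtype.val_injective.comp e.symm.injective, fun i => (e.symm i).2, fun ω => ?_,
    fun c c' i hc => ⟨ext c, ext c', e.symm i, fun v hv => ?_, rfl, rfl⟩⟩
  · refine hg fun v hv => ?_
    have hv' : v ∈ F := hv
    simp [ext, hv']
  · by_cases hvF : v ∈ F
    · simp only [ext, hvF, dif_pos]
      refine hc _ fun h => hv ?_
      rw [← h]; simp
    · simp [ext, hvF]

theorem integrable_of_dependsOn {F : Finset V} {g : (V → R) → ℝ} (hg : DependsOn g F) :
    Integrable g (iidPotential V p) := by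
  obtain ⟨ω₀⟩ : Nonempty (V → R) := (iidPotential V p).nonempty_of_neZero
  obtain ⟨ι, h, hι, -, hgh, -⟩ := exists_factor_of_dependsOn hg ω₀
  have hm : Measurable (fun (ω : V → R) (a : Fin F.card) => ω (ι a)) := by fun_prop
  rw [show g = h ∘ (fun (ω : V → R) (a : Fin F.card) => ω (ι a)) from funext hgh]
  refine Integrable.comp_measurable ?_ hm
  rw [iidPotential_map_comp p hι]
  exact Integrable.of_finite

theorem hasSubgaussianMGF_iidPotential {F : Finset V} {g : (V → R) → ℝ} (hg : DependsOn g F)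
    (hg1 : ∀ ω ω' v, (∀ x ≠ v, ω x = ω' x) → g ω ≤ g ω' + 1) :
    HasSubgaussianMGF (fun ω => g ω - ∫ ω, g ω ∂(iidPotential V p)) F.card
      (iidPotential V p) := by
  classical
  obtain ⟨ω₀⟩ : Nonempty (V → R) := (iidPotential V p).nonempty_of_neZero
  obtain ⟨ι, h, hι, -, hgh, hupd⟩ := exists_factor_of_dependsOn hg ω₀
  have hm : Measurable (fun (ω : V → R) (a : Fin F.card) => ω (ι a)) := by fun_prop
  have h1 : ∀ c c' i, (∀ j ≠ i, c j = c' j) → h c ≤ h c' + 1 := by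
    intro c c' i hc
    obtain ⟨ω, ω', v, hω, e1, e2⟩ := hupd c c' i hc
    rw [e1, e2]
    exact hg1 ω ω' v hω
  have h2 := hasSubgaussianMGF_pi_of_bounded_differences p.toMeasure F.card h h1
  have h3 : (Measure.pi fun _ : Fin F.card => p.toMeasure) =
      (iidPotential V p).map (fun ω a => ω (ι a)) := by
    rw [iidPotential_map_comp p hι, iidPotential, Measure.infinitePi_eq_pi]
  have h4 : ∫ ω, g ω ∂(iidPotential V p) =
      ∫ c, h c ∂(Measure.pi fun _ : Fin F.card => p.toMeasure) := by
    simp only [hgh]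
    rw [integral_iidPotential_comp p hι, iidPotential, Measure.infinitePi_eq_pi]
  rw [h4]
  rw [h3] at h2 ⊢
  have h5 := HasSubgaussianMGF.of_map hm.aemeasurable h2
  simp only [hgh]
  exact h5

/-- The Chernoff bound for `g` and for `-g`, with variance proxy `|F|`. -/
theorem measure_abs_sub_ge_le {F : Finset V} {g : (V → R) → ℝ} (hg : DependsOn g F)
    (hg1 : ∀ ω ω' v, (∀ x ≠ v, ω x = ω' x) → g ω ≤ g ω' + 1) {r : ℝ}
    (hr : 0 ≤ r) :
    (iidPotential V p).real {ω | r ≤ |g ω - ∫ ω, g ω ∂(iidPotential V p)|} ≤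
      2 * Real.exp (-r ^ 2 / (2 * F.card)) := by
  have h1 := hasSubgaussianMGF_iidPotential p hg hg1
  have h2 := h1.measure_ge_le hr
  have h3 := h1.neg.measure_ge_le hr
  rw [two_mul]
  refine (measureReal_mono ?_).trans ((measureReal_union_le _ _).trans (add_le_add h2 h3))
  intro ω hω
  rcases le_abs.1 (show r ≤ |_| from hω) with h | h
  · exact Or.inl h
  · exact Or.inr h

end iid

/-! ### Borel–Cantelli and almost sure concentration. -/

theorem IsSubexponential.summable_mul_exp {g : ℕ → ℕ} (hg : IsSubexponential g) {c : ℝ}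
    (hc : 0 < c) : Summable fun k : ℕ => (g k : ℝ) * Real.exp (-c * k) := by
  have hexp : 1 < Real.exp c := Real.one_lt_exp_iff.2 hc
  -- This choice puts `1 + δ` halfway between `1` and `exp c`, giving a geometric ratio below `1`.
  obtain ⟨C, hC, h⟩ := hg ((Real.exp c - 1) / 2) (by linarith)
  have hgeo : Summable fun k : ℕ => C * ((1 + (Real.exp c - 1) / 2) / Real.exp c) ^ k :=
    (summable_geometric_of_lt_one (by positivity)
      ((div_lt_one (Real.exp_pos c)).2 (by linarith))).mul_left C
  rw [← summable_nat_add_iff 1] at hgeo ⊢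
  refine Summable.of_nonneg_of_le (fun k => by positivity) (fun k => ?_) hgeo
  have h1 := h (k + 1) (by omega)
  have h2 : Real.exp (-c * ((k + 1 : ℕ) : ℝ)) = (Real.exp c ^ (k + 1))⁻¹ := by
    rw [← Real.exp_nat_mul, ← Real.exp_neg]; ring_nf
  rw [h2, div_pow, ← mul_div_assoc, div_eq_mul_inv]
  exact mul_le_mul_of_nonneg_right h1 (by positivity)

/-- Borel–Cantelli along a sequence of finite sets of which there are subexponentially many. -/
theorem ae_eventually_notMem_of_subexponential {V Ω : Type*} [MeasurableSpace Ω] {μ : Measure Ω}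
    [IsFiniteMeasure μ]
    {F : ℕ → Finset V} (hF : Tendsto (fun n => (F n).card) atTop atTop)
    (hsub : IsSubexponential (fun k => {S : Finset V | S ∈ Set.range F ∧ S.card = k}.ncard))
    (B : Finset V → Set Ω) {C c : ℝ} (hc : 0 < c)
    (hB : ∀ S, μ.real (B S) ≤ C * Real.exp (-c * S.card)) :
    ∀ᵐ ω ∂μ, ∀ᶠ n in atTop, ω ∉ B (F n) := by
  -- Finiteness makes `ncard` a genuine count rather than its default value `0`.
  have hfin : ∀ k, {S : Finset V | S ∈ Set.range F ∧ S.card = k}.Finite := by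
    intro k
    obtain ⟨N, hN⟩ := eventually_atTop.1 (hF.eventually (eventually_gt_atTop k))
    refine ((Set.finite_Iio N).image F).subset ?_
    rintro _ ⟨⟨n, rfl⟩, hn⟩
    refine ⟨n, ?_, rfl⟩
    by_contra h
    exact (hN n (not_lt.1 h)).ne' hn
  -- The sum runs over distinct sets, so repetitions in the sequence cost nothing.
  have hsum : ∑' S : Set.range F, μ (B S) ≠ ⊤ := by
    rw [← ENNReal.tsum_fiberwise _ (fun S : Set.range F => (S : Finset V).card)]
    have hle : ∀ k : ℕ, ∑' S : (fun S : Set.range F => (S : Finset V).card) ⁻¹' {k}, μ (B S) ≤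
        ENNReal.ofReal (C * (({S : Finset V | S ∈ Set.range F ∧ S.card = k}.ncard : ℝ) *
          Real.exp (-c * k))) := by
      intro k
      have hb : ∀ S : (fun S : Set.range F => (S : Finset V).card) ⁻¹' {k}, μ (B S) ≤
          ENNReal.ofReal (C * Real.exp (-c * k)) := by
        rintro ⟨S, hS⟩
        rw [← ENNReal.ofReal_toReal (measure_ne_top μ (B S))]
        refine ENNReal.ofReal_le_ofReal ?_
        have := hB S
        rwa [show (S : Finset V).card = k from hS] at this
      refine (ENNReal.tsum_le_tsum hb).trans ?_
      rw [ENNReal.tsum_const]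
      have hcard : ENat.card ((fun S : Set.range F => (S : Finset V).card) ⁻¹' {k}) =
          {S : Finset V | S ∈ Set.range F ∧ S.card = k}.ncard := by
        rw [(hfin k).cast_ncard_eq, ← ENat.card_coe_set_eq]
        refine ENat.card_congr ⟨fun S => ⟨S.1.1, S.1.2, S.2⟩, fun S => ⟨⟨S.1, S.2.1⟩, S.2.2⟩,
          fun _ => rfl, fun _ => rfl⟩
      rw [hcard]
      rw [mul_left_comm, ENNReal.ofReal_mul (Nat.cast_nonneg _)]
      simp
    refine ne_top_of_le_ne_top ?_ (ENNReal.tsum_le_tsum hle)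
    exact ((hsub.summable_mul_exp hc).mul_left C).tsum_ofReal_ne_top
  have : Countable (Set.range F) := (Set.countable_range F).to_subtype
  filter_upwards [ae_finite_setOfPred_mem hsum] with ω hω
  have hbad : (Subtype.val '' {S : Set.range F | ω ∈ B S}).Finite := hω.image _
  -- The finitely many bad sets have bounded size, which `|F n|` eventually exceeds.
  obtain ⟨K, hK⟩ := (hbad.image Finset.card).bddAbove
  filter_upwards [hF.eventually (eventually_gt_atTop K)] with n hn hmem
  exact hn.not_ge (hK ⟨F n, ⟨⟨F n, n, rfl⟩, hmem, rfl⟩, rfl⟩)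

namespace SimpleGraph

variable {V : Type*} (G : SimpleGraph V) {R : Finset ℝ} (p : PMF R)

theorem dependsOn_schrodingerDistribution (F : Finset V) (t : ℝ) :
    DependsOn (fun ω : V → R => G.schrodingerDistribution F (fun v => (ω v : ℝ)) t) F := by
  intro ω ω' h
  simp only [schrodingerDistribution]
  congr 2
  funext x
  exact congrArg Subtype.val (h x x.2)

/-- The expectation of the spectral distribution function. -/
noncomputable def meanDistribution (F : Finset V) (t : ℝ) : ℝ :=
  ∫ ω, G.schrodingerDistribution F (fun v => (ω v : ℝ)) t ∂(iidPotential V p)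

/-- The unnormalized count `|S| N_S` has differences bounded by `1`; a deviation `ε |S|` gives the
exponent `(ε |S|)² / (2 |S|) = (ε² / 2) |S|`, exponential in `|S|` as Borel–Cantelli requires. -/
theorem ae_tendsto_sub_meanDistribution {F : ℕ → Finset V}
    (hF : Tendsto (fun n => (F n).card) atTop atTop)
    (hsub : IsSubexponential (fun k => {S : Finset V | S ∈ Set.range F ∧ S.card = k}.ncard))
    (t : ℝ) :
    ∀ᵐ ω ∂(iidPotential V p), Tendsto (fun n =>
      G.schrodingerDistribution (F n) (fun v => (ω v : ℝ)) t - G.meanDistribution p (F n) t)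
      atTop (𝓝 0) := by
  have key : ∀ m : ℕ, ∀ᵐ ω ∂(iidPotential V p), ∀ᶠ n in atTop,
      |G.schrodingerDistribution (F n) (fun v => (ω v : ℝ)) t - G.meanDistribution p (F n) t| <
        1 / ((m : ℝ) + 1) := by
    intro m
    have hε : 0 < 1 / ((m : ℝ) + 1) := by positivity
    set ε := 1 / ((m : ℝ) + 1)
    have h := ae_eventually_notMem_of_subexponential (μ := iidPotential V p) hF hsub
      (fun S => {ω | ε * S.card ≤
        |S.card * G.schrodingerDistribution S (fun v => (ω v : ℝ)) t -
          ∫ ω, S.card * G.schrodingerDistribution S (fun v => (ω v : ℝ)) t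
            ∂(iidPotential V p)|})
      (C := 2) (c := ε ^ 2 / 2) (by positivity) ?_
    · filter_upwards [h] with ω hω
      filter_upwards [hω] with n hn
      simp only [not_le, integral_const_mul, ← mul_sub, abs_mul,
        Nat.abs_cast] at hn
      rw [mul_comm ε] at hn
      exact lt_of_mul_lt_mul_left hn (Nat.cast_nonneg _)
    · intro S
      refine (measure_abs_sub_ge_le p (F := S) ?_ ?_ (by positivity)).trans_eq ?_
      · intro ω ω' h
        exact congrArg (fun x : ℝ => (S.card : ℝ) * x)
          (G.dependsOn_schrodingerDistribution S t h)
      · exact fun ω ω' v hω => G.card_mul_schrodingerDistribution_le S (v := v)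
          (fun x _ hx => congrArg Subtype.val (hω x hx)) t
      · rcases S.eq_empty_or_nonempty with rfl | hS
        · simp
        · have : (S.card : ℝ) ≠ 0 := by exact_mod_cast hS.card_pos.ne'
          congr 2
          field_simp
  filter_upwards [ae_all_iff.2 key] with ω hω
  rw [Metric.tendsto_atTop']
  intro ε hε
  obtain ⟨m, hm⟩ := exists_nat_one_div_lt hε
  obtain ⟨N, hN⟩ := eventually_atTop.1 (hω m)
  refine ⟨N, fun n hn => ?_⟩
  rw [Real.dist_eq, sub_zero]
  exact (hN n hn.le).trans hm

end SimpleGraph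

/-! ### Locality of moments and convergence of mean traces. -/

namespace SimpleGraph

open Classical in
-- With the degree absorbed into differences, an edge contributes nothing when `u` vanishes at both
-- ends, so graphs can be compared edge by edge.
theorem schrodinger_mulVec {W : Type*} [Fintype W] (K : SimpleGraph W) (ω u : W → ℝ) (y : W) :
    (K.schrodinger ω).mulVec u y =
      (∑ z, if K.Adj y z then u y - u z else 0) + ω y * u y := by
  rw [schrodinger, Matrix.add_mulVec, Pi.add_apply, Matrix.mulVec_diagonal, lapMatrix_mulVec_apply]
  congr 1
  rw [← Finset.sum_filter, Finset.sum_sub_distrib, Finset.sum_const, nsmul_eq_mul,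
    ← card_neighborFinset_eq_degree, neighborFinset_eq_filter]

open Classical in
/-- Powers of the Schrödinger operator only see the ball around the root. -/
theorem schrodinger_pow_apply_eq_of_ball {W A : Type*} [Fintype W] [Fintype A] (K : SimpleGraph W)
    (H : SimpleGraph A) (ω : W → ℝ) {ι : A → W} (hι : Function.Injective ι)
    (hadj : ∀ a b, H.Adj a b ↔ K.Adj (ι a) (ι b)) {o : A} {x : W} (ho : ι o = x) {r : ℕ}
    (hr : ∀ y, K.edist x y ≤ r → y ∈ Set.range ι) {k : ℕ} (hk : k ≤ r) :
    (K.schrodinger ω ^ k) x x = (H.schrodinger (fun a => ω (ι a)) ^ k) o o := by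
  have key : ∀ j ≤ r,
      (∀ y, (j : ℕ∞) < K.edist x y →
        ((K.schrodinger ω ^ j).mulVec (Pi.single x 1)) y = 0) ∧
      ∀ a, ((K.schrodinger ω ^ j).mulVec (Pi.single x 1)) (ι a) =
        ((H.schrodinger (fun a => ω (ι a)) ^ j).mulVec (Pi.single o 1)) a := by
    intro j
    induction j with
    | zero =>
      refine fun _ => ⟨fun y hy => ?_, fun a => ?_⟩
      · have : y ≠ x := by rintro rfl; simp at hy
        simp [this]
      · simp only [pow_zero, Matrix.one_mulVec, Pi.single_apply, ← ho, hι.eq_iff]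
    | succ j ih =>
      intro hj
      obtain ⟨h0, h1⟩ := ih (by omega)
      simp only [pow_succ', ← Matrix.mulVec_mulVec]
      set u := (K.schrodinger ω ^ j).mulVec (Pi.single x 1)
      set u' := (H.schrodinger (fun a => ω (ι a)) ^ j).mulVec (Pi.single o 1)
      have hnb : ∀ y z, K.Adj y z → ((j + 1 : ℕ) : ℕ∞) < K.edist x y → (j : ℕ∞) < K.edist x z := by
        intro y z hyz hy
        by_contra hz
        refine hy.not_ge (K.edist_triangle.trans
          (add_le_add (not_lt.1 hz) (edist_eq_one_iff_adj.2 hyz.symm).le) |>.trans ?_)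
        simp
      refine ⟨fun y hy => ?_, fun a => ?_⟩
      · have hy' : (j : ℕ∞) < K.edist x y := lt_of_le_of_lt (by simp) hy
        rw [schrodinger_mulVec, h0 y hy', mul_zero, add_zero]
        refine Finset.sum_eq_zero fun z _ => ?_
        split_ifs with hyz
        · rw [h0 z (hnb y z hyz hy), sub_zero]
        · rfl
      · rw [schrodinger_mulVec, schrodinger_mulVec, h1 a]
        congr 1
        symm
        refine Finset.sum_of_injOn ι hι.injOn (fun _ _ => Finset.mem_univ _) ?_ ?_
        · intro z _ hz
          -- A neighbour missing from the ball is at distance above `r ≥ j + 1`, so `u` vanishes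
          -- there and at `ι a`. The missing edge, and hence the wrong degree at the rim of the
          -- ball, is harmless.
          have hz' : (r : ℕ∞) < K.edist x z := by
            by_contra h
            obtain ⟨b, hb⟩ := hr z (not_lt.1 h)
            exact hz ⟨b, Finset.mem_coe.2 (Finset.mem_univ b), hb⟩
          split_ifs with haz
          · have hj' : ((j + 1 : ℕ) : ℕ∞) ≤ r := by exact_mod_cast hj
            rw [← h1 a, h0 _ (hnb _ _ haz.symm (hj'.trans_lt hz')),
              h0 z (lt_of_le_of_lt (by exact_mod_cast (by omega : j ≤ r)) hz'), sub_zero]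
          · rfl
        · intro b _
          simp only [hadj, h1]
  have := (key k hk).2 o
  rw [ho] at this
  simpa using this

/-- A walk of length at most `r` to the centre stays in the ball, because each of its tails is such
a walk. -/
theorem edist_induce_closedBall_le {W : Type*} (K : SimpleGraph W) (x : W) (r : ℕ)
    (hx : x ∈ K.closedBall x r) {y : W} (w : K.Walk y x) :
    w.length ≤ r → ∀ hy : y ∈ K.closedBall x r,
      (K.induce (K.closedBall x r)).edist ⟨x, hx⟩ ⟨y, hy⟩ ≤ (w.length : ℕ∞) := by
  induction w with
  | nil => intro _ _; simp
  | @cons y z x h w ih =>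
    intro hw hy
    rw [Walk.length_cons] at hw
    have hz : z ∈ K.closedBall x r := by
      have h1 : K.edist z x ≤ (w.length : ℕ∞) := edist_le w
      have h2 : (w.length : ℕ∞) ≤ r := by exact_mod_cast (by omega : w.length ≤ r)
      rw [SimpleGraph.edist_comm] at h1
      exact h1.trans h2
    have h1 := ih hx (by omega) hz
    have h2 : (K.induce (K.closedBall x r)).Adj ⟨z, hz⟩ ⟨y, hy⟩ := h.symm
    rw [Walk.length_cons, Nat.cast_add, Nat.cast_one]
    exact SimpleGraph.edist_triangle.trans (add_le_add h1 (edist_eq_one_iff_adj.2 h2).le)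

theorem isRootedBall_of_mem_patchSet {W A : Type*} {K : SimpleGraph W} {H : SimpleGraph A} {o : A}
    {r : ℕ} {x : W} (hx : x ∈ K.patchSet H o r) : H.IsRootedBall o r := by
  obtain ⟨e, he⟩ := hx
  intro a
  have hxb : x ∈ K.closedBall x r := by simp [closedBall]
  have hy : K.edist x (e a) ≤ r := (e a).2
  obtain ⟨w, hw⟩ := exists_walk_of_edist_ne_top (ne_top_of_le_ne_top (ENat.natCast_ne_top r) hy)
  rw [← hw] at hy
  have hwr : w.reverse.length ≤ r := by rw [Walk.length_reverse]; exact_mod_cast hy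
  have h1 := K.edist_induce_closedBall_le x r hxb w.reverse hwr (e a).2
  have h2 : e o = ⟨x, hxb⟩ := Subtype.ext he
  obtain ⟨w', hw'⟩ := exists_walk_of_edist_ne_top (ne_top_of_le_ne_top (ENat.natCast_ne_top _) h1)
  rw [← hw'] at h1
  have h3 : H.edist (e.symm ⟨x, hxb⟩) (e.symm (e a)) ≤ w'.length := by
    have := edist_le (w'.map e.symm.toHom)
    rwa [Walk.length_map] at this
  have h4 : e.symm ⟨x, hxb⟩ = o := by rw [← h2, e.symm_apply_apply]
  have h5 : e.symm (e a) = a := e.symm_apply_apply a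
  replace h3 : H.edist o a ≤ w'.length := by simpa only [h4, h5] using h3
  exact h3.trans (h1.trans (Nat.cast_le.2 hwr))

/-- Finite rooted graphs with at most `M` vertices. -/
abbrev RootedGraph (M : ℕ) : Type := Σ m : Fin (M + 1), SimpleGraph (Fin m) × Fin m

/-- Isomorphism of rooted graphs. -/
def rootedGraphSetoid (M : ℕ) : Setoid (RootedGraph M) where
  r τ τ' := ∃ e : τ.2.1 ≃g τ'.2.1, e τ.2.2 = τ'.2.2
  iseqv := ⟨fun _ => ⟨Iso.refl, rfl⟩, fun ⟨e, h⟩ => ⟨e.symm, by rw [← h, e.symm_apply_apply]⟩,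
    fun ⟨e, h⟩ ⟨e', h'⟩ => ⟨e'.comp e, by rw [← h', ← h]; rfl⟩⟩

theorem exists_mem_patchSet {W : Type*} (K : SimpleGraph W) (x : W) (r : ℕ) {M : ℕ}
    (hM : (K.closedBall x r).encard ≤ M) :
    ∃ τ : RootedGraph M, x ∈ K.patchSet τ.2.1 τ.2.2 r := by
  have hfin : (K.closedBall x r).Finite := Set.finite_of_encard_le_coe hM
  have : Finite (K.closedBall x r) := hfin
  have hcard : Nat.card (K.closedBall x r) ≤ M := by
    rw [Nat.card_coe_set_eq]
    rw [← hfin.cast_ncard_eq] at hM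
    exact_mod_cast hM
  have hxb : x ∈ K.closedBall x r := by simp [closedBall]
  let e : Fin (Nat.card (K.closedBall x r)) ≃ K.closedBall x r := (Finite.equivFin _).symm
  refine ⟨⟨⟨Nat.card (K.closedBall x r), Nat.lt_succ_of_le hcard⟩,
    (K.induce (K.closedBall x r)).comap e, e.symm ⟨x, hxb⟩⟩, Iso.comap e _, ?_⟩
  exact congrArg Subtype.val (e.apply_symm_apply ⟨x, hxb⟩)

/-- Averages of functions of the rooted balls converge along weakly convergent sequences. -/
theorem WeaklyConvergent.tendsto_average {W : ℕ → Type*} [∀ n, Fintype (W n)]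
    {K : ∀ n, SimpleGraph (W n)} (hK : WeaklyConvergent K) {r : ℕ} (hr : 1 ≤ r) {M : ℕ}
    (hM : ∀ n x, ((K n).closedBall x r).encard ≤ M)
    (ψ : ∀ m, SimpleGraph (Fin m) → Fin m → ℝ) (g : ∀ n, W n → ℝ)
    (hg : ∀ n x m H (o : Fin m), x ∈ (K n).patchSet H o r → g n x = ψ m H o) :
    ∃ c, Tendsto (fun n => (∑ x, g n x) / Nat.card (W n)) atTop (𝓝 c) := by
  classical
  let s := rootedGraphSetoid M
  have : Fintype (Quotient s) := Fintype.ofFinite _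
  have hconv : ∀ q : Quotient s, ∃ c, Tendsto
      (fun n => (K n).patchFrequency q.out.2.1 q.out.2.2 r) atTop (𝓝 c) := by
    intro q
    by_cases h : (q.out.2.1).IsRootedBall q.out.2.2 r
    · exact hK.2 r hr _ _ _ h
    -- A class that is not a rooted `r`-ball occurs nowhere, and weak convergence says nothing about
    -- it.
    · refine ⟨0, tendsto_const_nhds.congr fun n => ?_⟩
      have : (K n).patchSet q.out.2.1 q.out.2.2 r = ∅ :=
        Set.eq_empty_of_forall_notMem fun x hx => h (isRootedBall_of_mem_patchSet hx)
      rw [patchFrequency, this]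
      simp
  choose c hc using hconv
  refine ⟨∑ q : Quotient s, c q * ψ _ q.out.2.1 q.out.2.2,
    (tendsto_finsetSum _ fun q _ => (hc q).mul_const _).congr fun n => ?_⟩
  choose τ hτ using fun x => exists_mem_patchSet (K n) x r (hM n x)
  -- The patch sets of the class representatives partition the vertices, so the average is a finite
  -- sum of frequencies times values.
  have hiff : ∀ x (q : Quotient s), x ∈ (K n).patchSet q.out.2.1 q.out.2.2 r ↔ ⟦τ x⟧ = q := by
    intro x q
    constructor
    · rintro ⟨e, he⟩
      obtain ⟨e', he'⟩ := hτ x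
      rw [← Quotient.out_eq q, Quotient.eq]
      refine ⟨e.symm.comp e', ?_⟩
      have : e' (τ x).2.2 = e q.out.2.2 := Subtype.ext (he'.trans he.symm)
      exact (congrArg e.symm this).trans (e.symm_apply_apply _)
    · rintro rfl
      obtain ⟨e', he'⟩ := hτ x
      obtain ⟨i, hi⟩ : (⟦τ x⟧ : Quotient s).out ≈ τ x := Quotient.mk_out (τ x)
      exact ⟨e'.comp i, (congrArg (fun z => (e' z : W n)) hi).trans he'⟩
  rw [Finset.sum_div, ← Finset.sum_fiberwise Finset.univ (fun x => (⟦τ x⟧ : Quotient s))]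
  refine Finset.sum_congr rfl fun q _ => ?_
  have h1 : ∀ x ∈ Finset.univ.filter (fun x => (⟦τ x⟧ : Quotient s) = q),
      g n x / Nat.card (W n) = ψ _ q.out.2.1 q.out.2.2 / Nat.card (W n) := by
    intro x hx
    rw [hg n x _ _ _ ((hiff x q).2 (Finset.mem_filter.1 hx).2)]
  have h2 : (K n).patchSet q.out.2.1 q.out.2.2 r =
      (Finset.univ.filter (fun x => (⟦τ x⟧ : Quotient s) = q) : Finset (W n)) := by
    ext x; simp [hiff]
  rw [Finset.sum_congr rfl h1, Finset.sum_const, nsmul_eq_mul, patchFrequency, h2,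
    Set.ncard_coe_finset]
  ring

variable {V : Type*} {R : Finset ℝ} (p : PMF R)

open Classical in
/-- The mean diagonal entry at `x` of the `k`-th power of the Schrödinger operator. -/
noncomputable def meanMoment {W : Type*} [Fintype W] (K : SimpleGraph W) (k : ℕ) (x : W) : ℝ :=
  ∫ c, (K.schrodinger (fun y => (c y : ℝ)) ^ k) x x ∂(iidPotential W p)

/-- The entry reads only the potential on the ball, whose law transported along the isomorphism is
again the product law. -/
theorem meanMoment_eq_of_mem_patchSet {W A : Type*} [Fintype W] [Fintype A] {K : SimpleGraph W}
    {H : SimpleGraph A} {o : A} {r k : ℕ} (hk : k ≤ r) {x : W} (hx : x ∈ K.patchSet H o r) :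
    K.meanMoment p k x = H.meanMoment p k o := by
  classical
  obtain ⟨e, he⟩ := hx
  have hι : Function.Injective (fun a => (e a : W)) := Subtype.val_injective.comp e.injective
  unfold meanMoment
  rw [← integral_iidPotential_comp p hι]
  refine integral_congr_ae (Eventually.of_forall fun c => ?_)
  exact K.schrodinger_pow_apply_eq_of_ball H (fun y => (c y : ℝ)) hι
    (fun a b => (e.map_adj_iff).symm) he
    (fun y hy => ⟨e.symm ⟨y, hy⟩, congrArg Subtype.val (e.apply_symm_apply ⟨y, hy⟩)⟩) hk

theorem closedBall_induce_encard_le {G : SimpleGraph V} (s : Set V) (x : s) (r : ℕ) :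
    ((G.induce s).closedBall x r).encard ≤ (G.closedBall x r).encard := by
  rw [← Subtype.val_injective.encard_image]
  refine Set.encard_le_encard ?_
  rintro _ ⟨y, hy, rfl⟩
  have hy : (G.induce s).edist x y ≤ r := hy
  obtain ⟨w, hw⟩ := exists_walk_of_edist_ne_top (ne_top_of_le_ne_top (ENat.natCast_ne_top r) hy)
  have := edist_le (w.map (Embedding.induce s).toHom)
  rw [Walk.length_map, hw] at this
  exact this.trans hy

open Classical in
/-- The trace of `q(A)` for a real symmetric matrix `A`. -/
noncomputable def _root_.Matrix.IsHermitian.evalTrace {W : Type*} [Fintype W] {A : Matrix W W ℝ}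
    (hA : A.IsHermitian) (q : Polynomial ℝ) : ℝ :=
  ∑ i, q.eval (hA.eigenvalues i)

open Classical in
theorem _root_.Matrix.IsHermitian.evalTrace_eq {W : Type*} [Fintype W] {A : Matrix W W ℝ}
    (hA : A.IsHermitian) (q : Polynomial ℝ) :
    hA.evalTrace q = ∑ k ∈ q.support, q.coeff k * ∑ x, (A ^ k) x x := by
  simp only [Matrix.IsHermitian.evalTrace, Polynomial.eval_eq_sum, Polynomial.sum_def]
  rw [Finset.sum_comm]
  refine Finset.sum_congr rfl fun k _ => ?_
  rw [← Finset.mul_sum, ← hA.trace_pow_eq_sum]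
  rfl

theorem integral_evalTrace {W : Type*} [Fintype W] (K : SimpleGraph W) (q : Polynomial ℝ) :
    ∫ c, (K.isHermitian_schrodinger (fun x => ((c x : R) : ℝ))).evalTrace q ∂(iidPotential W p) =
      ∑ k ∈ q.support, q.coeff k * ∑ x, K.meanMoment p k x := by
  simp only [Matrix.IsHermitian.evalTrace_eq]
  rw [integral_finsetSum _ fun _ _ => Integrable.of_finite]
  refine Finset.sum_congr rfl fun k _ => ?_
  rw [integral_const_mul, integral_finsetSum _ fun _ _ => Integrable.of_finite]
  rfl

/-- The mean of the normalized trace of a polynomial of the Schrödinger operator. -/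
noncomputable def meanTrace (G : SimpleGraph V) (F : Finset V) (q : Polynomial ℝ) : ℝ :=
  ∫ ω, ((G.induce {x : V | x ∈ F}).isHermitian_schrodinger
    (fun x => (ω x : ℝ))).evalTrace q / F.card ∂(iidPotential V p)

theorem meanTrace_eq (G : SimpleGraph V) (F : Finset V) (q : Polynomial ℝ) :
    G.meanTrace p F q = ∑ k ∈ q.support, q.coeff k *
      ((∑ x, (G.induce {x : V | x ∈ F}).meanMoment p k x) / F.card) := by
  have h1 := integral_iidPotential_comp p
    (Subtype.val_injective : Function.Injective (Subtype.val : {x : V | x ∈ F} → V))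
    (fun c => ((G.induce {x : V | x ∈ F}).isHermitian_schrodinger
      (fun x => (c x : ℝ))).evalTrace q)
  rw [meanTrace, integral_div]
  refine (congrArg (fun z : ℝ => z / F.card) (h1.trans (integral_evalTrace p _ q))).trans ?_
  simp only [Finset.sum_div, mul_div_assoc]

theorem exists_tendsto_meanTrace {G : SimpleGraph V} {f : ℕ → ℕ}
    (hball : ∀ (x : V) (r : ℕ), 1 ≤ r → (G.closedBall x r).encard ≤ (f r : ℕ∞))
    {F : ℕ → Finset V} (hF : WeaklyConvergent (fun n => G.induce {x : V | x ∈ F n}))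
    (q : Polynomial ℝ) :
    ∃ c, Tendsto (fun n => G.meanTrace p (F n) q) atTop (𝓝 c) := by
  have h : ∀ k : ℕ, ∃ c, Tendsto (fun n =>
      (∑ x, (G.induce {x : V | x ∈ F n}).meanMoment p k x) / (F n).card) atTop (𝓝 c) := by
    intro k
    -- Radius `k` would suffice, but the radius must be at least `1` even for `k = 0`.
    obtain ⟨c, hc⟩ := hF.tendsto_average (r := k + 1) (by omega) (M := f (k + 1))
      (fun n x => (closedBall_induce_encard_le _ _ _).trans (hball _ _ (by omega)))
      (fun m H o => H.meanMoment p k o) (fun n x => (G.induce {x : V | x ∈ F n}).meanMoment p k x)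
      (fun n x m H o hx => meanMoment_eq_of_mem_patchSet p (Nat.le_succ k) hx)
    refine ⟨c, hc.congr fun n => ?_⟩
    rw [Nat.card_eq_fintype_card, card_setOf_mem]
  choose c hc using h
  refine ⟨∑ k ∈ q.support, q.coeff k * c k, ?_⟩
  simp only [meanTrace_eq]
  exact tendsto_finsetSum _ fun k _ => (hc k).const_mul _

end SimpleGraph

/-! ### From polynomials to distribution functions. -/

theorem exists_tendsto_of_approx {a : ℕ → ℝ}
    (h : ∀ ε > 0, ∃ (b : ℕ → ℝ) (c : ℝ), Tendsto b atTop (𝓝 c) ∧ ∀ n, |a n - b n| ≤ ε) :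
    ∃ L, Tendsto a atTop (𝓝 L) := by
  refine cauchySeq_tendsto_of_complete (Metric.cauchySeq_iff'.2 fun ε hε => ?_)
  obtain ⟨b, c, hb, hab⟩ := h (ε / 4) (by positivity)
  obtain ⟨N, hN⟩ := Metric.cauchySeq_iff'.1 hb.cauchySeq (ε / 4) (by positivity)
  refine ⟨N, fun n hn => ?_⟩
  have h1 := hN n hn
  rw [Real.dist_eq] at h1 ⊢
  have h2 := abs_le.1 (hab n)
  have h3 := abs_le.1 (hab N)
  have h4 := abs_lt.1 h1
  rw [abs_lt]
  constructor <;> linarith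

namespace SimpleGraph

open Classical in
-- Gershgorin: the diagonal is at most `d + ∑ |r|` in modulus and each off-diagonal row sum at most
-- `d`. The common bound gives one compact interval for Weierstrass approximation.
theorem abs_eigenvalues_schrodinger_le {W : Type*} [Fintype W] {K : SimpleGraph W} {d : ℕ}
    (hd : ∀ x, K.degree x ≤ d) {R : Finset ℝ} {ω : W → ℝ} (hω : ∀ x, ω x ∈ R) (i : W) :
    |(K.isHermitian_schrodinger ω).eigenvalues i| ≤ 2 * d + ∑ r ∈ R, |r| := by
  set hA := K.isHermitian_schrodinger ω
  have hev : Module.End.HasEigenvalue (Matrix.toLin' (K.schrodinger ω)) (hA.eigenvalues i) := by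
    refine Module.End.hasEigenvalue_of_hasEigenvector (x := ⇑(hA.eigenvectorBasis i))
      ⟨Module.End.mem_eigenspace_iff.2 (hA.mulVec_eigenvectorBasis i), fun h => ?_⟩
    exact hA.eigenvectorBasis.orthonormal.ne_zero i ((WithLp.ofLp_eq_zero 2).1 h)
  obtain ⟨x, hx⟩ := eigenvalue_mem_ball hev
  rw [Metric.mem_closedBall, Real.dist_eq] at hx
  have h1 : ∑ j ∈ Finset.univ.erase x, ‖K.schrodinger ω x j‖ ≤ d := by
    have : ∀ j ∈ Finset.univ.erase x, ‖K.schrodinger ω x j‖ = if K.Adj x j then (1 : ℝ) else 0 := by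
      intro j hj
      rw [schrodinger_apply, if_neg (Finset.ne_of_mem_erase hj).symm]
      split_ifs <;> simp
    rw [Finset.sum_congr rfl this]
    refine (Finset.sum_le_sum_of_subset_of_nonneg (Finset.erase_subset _ _)
      fun _ _ _ => by positivity).trans ?_
    rw [Finset.sum_boole, ← neighborFinset_eq_filter, card_neighborFinset_eq_degree]
    exact_mod_cast hd x
  have h2 : |K.schrodinger ω x x| ≤ d + ∑ r ∈ R, |r| := by
    rw [schrodinger_apply, if_pos rfl]
    refine (abs_add_le _ _).trans (add_le_add ?_ ?_)
    · rw [Nat.abs_cast]; exact_mod_cast hd x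
    · exact Finset.single_le_sum (f := fun r : ℝ => |r|) (fun r _ => abs_nonneg r) (hω x)
  have h3 := abs_sub_abs_le_abs_sub (hA.eigenvalues i) (K.schrodinger ω x x)
  linarith

variable {V : Type*} {G : SimpleGraph V} {f : ℕ → ℕ}

/-- The spectral distribution functions at `t` are uniformly approximated by normalized traces of a
polynomial. -/
theorem exists_polynomial_approx (hf : IsSubexponential f)
    (hball : ∀ (x : V) (r : ℕ), 1 ≤ r → (G.closedBall x r).encard ≤ (f r : ℕ∞))
    (R : Finset ℝ) (t : ℝ) {ε : ℝ} (hε : 0 < ε) :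
    ∃ q : Polynomial ℝ, ∀ (F : Finset V) (ω : V → ℝ), (∀ v, ω v ∈ R) →
      |G.schrodingerDistribution F ω t - ((G.induce {x : V | x ∈ F}).isHermitian_schrodinger
        (fun x => ω (x : V))).evalTrace q / F.card| ≤ 2 * ε := by
  classical
  obtain ⟨S, hS, hjump⟩ := exists_finite_jumps hf hball R hε
  obtain ⟨s, hs, hts⟩ : ∃ s, (∀ u ∈ S, u ≤ t ∨ s < u) ∧ t < s := by
    have h1 : ∀ᶠ s in 𝓝[>] t, ∀ u ∈ S, u ≤ t ∨ s < u := by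
      rw [eventually_all_finite hS]
      intro u _
      rcases le_or_gt u t with h | h
      · exact Eventually.of_forall fun _ => Or.inl h
      · exact (eventually_nhdsWithin_of_eventually_nhds (gt_mem_nhds h)).mono fun _ => Or.inr
    exact (h1.and self_mem_nhdsWithin).exists
  have hst : 0 < s - t := sub_pos.2 hts
  set C : ℝ := 2 * f 1 + ∑ r ∈ R, |r|
  -- This ramp lies between the indicators of `(-∞, t]` and `(-∞, s]`, whose normalized counts
  -- differ by at most `ε` because `S` misses `(t, s]`. Weierstrass costs the other `ε`.
  let g : ℝ → ℝ := fun x => max 0 (min 1 ((s - x) / (s - t)))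
  have hg : Continuous g := by fun_prop
  obtain ⟨q, hq⟩ := exists_polynomial_near_of_continuousOn (-C) C g hg.continuousOn ε hε
  refine ⟨q, fun F ω hω => ?_⟩
  have hjump' := hjump F ω hω t s hs
  rw [schrodingerDistribution, Matrix.IsHermitian.spectralDistribution_eq, card_setOf_mem] at *
  rw [schrodingerDistribution, Matrix.IsHermitian.spectralDistribution_eq, card_setOf_mem]
    at hjump'
  rcases F.eq_empty_or_nonempty with rfl | hF
  · simpa using hε.le
  have hFpos : (0 : ℝ) < F.card := by exact_mod_cast hF.card_pos
  have hbd : ∀ i, |((G.induce {x : V | x ∈ F}).isHermitian_schrodinger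
      (fun x => ω (x : V))).eigenvalues i| ≤ C := fun i => abs_eigenvalues_schrodinger_le
    (degree_induce_le (fun x => hball x 1 le_rfl) F) (fun x => hω x) i
  set hA := (G.induce {x : V | x ∈ F}).isHermitian_schrodinger (fun x => ω (x : V))
  have hcount : ∀ u, (hA.eigenvalueCount u : ℝ) =
      ∑ i, if hA.eigenvalues i ≤ u then (1 : ℝ) else 0 := by
    intro u
    rw [Finset.sum_boole, ← Fintype.card_subtype, ← Nat.card_eq_fintype_card]
    rfl
  have h1 : (hA.eigenvalueCount t : ℝ) ≤ ∑ i, g (hA.eigenvalues i) := by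
    rw [hcount]
    refine Finset.sum_le_sum fun i _ => ?_
    split_ifs with h
    · refine le_max_of_le_right (le_min le_rfl ?_)
      rw [le_div_iff₀ hst]; linarith
    · exact le_max_left _ _
  have h2 : ∑ i, g (hA.eigenvalues i) ≤ hA.eigenvalueCount s := by
    rw [hcount]
    refine Finset.sum_le_sum fun i _ => ?_
    split_ifs with h
    · exact max_le zero_le_one (min_le_left _ _)
    · refine max_le le_rfl ((min_le_right _ _).trans ?_)
      exact div_nonpos_of_nonpos_of_nonneg (by linarith) hst.le
  have h3 : |hA.evalTrace q - ∑ i, g (hA.eigenvalues i)| ≤ F.card * ε := by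
    have : hA.evalTrace q = ∑ i, q.eval (hA.eigenvalues i) := rfl
    rw [this, ← Finset.sum_sub_distrib]
    refine (Finset.abs_sum_le_sum_abs _ _).trans ?_
    refine (Finset.sum_le_sum fun i _ => (hq _ (abs_le.1 (hbd i))).le).trans ?_
    rw [Finset.sum_const, nsmul_eq_mul, Finset.card_univ, card_setOf_mem]
  rw [← sub_le_iff_le_add', ← sub_div, div_le_iff₀ hFpos] at hjump'
  rw [← sub_div, abs_div, Nat.abs_cast, div_le_iff₀ hFpos]
  have h4 := abs_le.1 h3
  rw [abs_le]
  constructor <;> linarith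

/-- Up to an error `ε`, the spectral distribution functions of all finite induced subgraphs and all
potentials are determined by their values at finitely many points. -/
theorem exists_finite_net (hf : IsSubexponential f)
    (hball : ∀ (x : V) (r : ℕ), 1 ≤ r → (G.closedBall x r).encard ≤ (f r : ℕ∞))
    (R : Finset ℝ) {ε : ℝ} (hε : 0 < ε) :
    ∃ T : Set ℝ, T.Finite ∧ ∀ s, ∃ s' ∈ T, ∀ (F : Finset V) (ω : V → ℝ), (∀ v, ω v ∈ R) →
      |G.schrodingerDistribution F ω s - G.schrodingerDistribution F ω s'| ≤ ε := by
  obtain ⟨S, hS, hjump⟩ := exists_finite_jumps hf hball R hε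
  obtain ⟨b, hb⟩ := hS.bddBelow
  have key : ∀ s s', s' ≤ s → (∀ u ∈ S, u ≤ s' ∨ s < u) → ∀ (F : Finset V) (ω : V → ℝ),
      (∀ v, ω v ∈ R) →
      |G.schrodingerDistribution F ω s - G.schrodingerDistribution F ω s'| ≤ ε := by
    intro s s' hss hu F ω hω
    have h1 := hjump F ω hω s' s hu
    have h2 := G.schrodingerDistribution_mono F ω hss
    rw [abs_le]
    constructor <;> linarith
  -- Each `s` is represented by the largest point of `S` not above it; `b - 1` serves every `s`
  -- lying below all of `S`.
  refine ⟨insert (b - 1) S, hS.insert _, fun s => ?_⟩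
  by_cases h : ∃ u ∈ S, u ≤ s
  · obtain ⟨u, hu, hmax⟩ := Set.exists_max_image (S ∩ Set.Iic s) id (hS.inter_of_left _)
      (by obtain ⟨u, hu, hus⟩ := h; exact ⟨u, hu, hus⟩)
    refine ⟨u, Set.mem_insert_of_mem _ hu.1, key s u hu.2 fun w hw => ?_⟩
    rcases le_or_gt w s with hws | hws
    · exact Or.inl (hmax w ⟨hw, hws⟩)
    · exact Or.inr hws
  · push Not at h
    refine ⟨b - 1, Set.mem_insert _ _, ?_⟩
    rcases le_total (b - 1) s with hs | hs
    · exact key s (b - 1) hs fun u hu => Or.inr (h u hu)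
    · intro F ω hω
      rw [abs_sub_comm]
      exact key (b - 1) s hs (fun u hu => Or.inr (by linarith [hb hu])) F ω hω

variable {R : Finset ℝ} (p : PMF R)

theorem integrable_schrodingerDistribution (G : SimpleGraph V) (F : Finset V) (t : ℝ) :
    Integrable (fun ω : V → R => G.schrodingerDistribution F (fun v => (ω v : ℝ)) t)
      (iidPotential V p) :=
  integrable_of_dependsOn p (G.dependsOn_schrodingerDistribution F t)

theorem integrable_evalTrace (G : SimpleGraph V) (F : Finset V) (q : Polynomial ℝ) :
    Integrable (fun ω : V → R => ((G.induce {x : V | x ∈ F}).isHermitian_schrodinger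
      (fun x => (ω x : ℝ))).evalTrace q / F.card) (iidPotential V p) := by
  refine integrable_of_dependsOn p (F := F) fun ω ω' h => ?_
  congr 2
  congr 1
  funext x
  exact congrArg Subtype.val (h x x.2)

theorem abs_integral_sub_integral_le {Ω : Type*} [MeasurableSpace Ω] {μ : Measure Ω}
    [IsProbabilityMeasure μ] {a b : Ω → ℝ} (ha : Integrable a μ) (hb : Integrable b μ) {ε : ℝ}
    (h : ∀ ω, |a ω - b ω| ≤ ε) : |∫ ω, a ω ∂μ - ∫ ω, b ω ∂μ| ≤ ε := by
  rw [← integral_sub ha hb, ← Real.norm_eq_abs]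
  have := norm_integral_le_of_norm_le_const (μ := μ) (f := fun ω => a ω - b ω) (C := ε)
    (Eventually.of_forall h)
  simpa using this

/-- Mean polynomial traces converge and approximate the mean distribution uniformly in `n`, which
makes the latter Cauchy. -/
theorem exists_tendsto_meanDistribution (hf : IsSubexponential f)
    (hball : ∀ (x : V) (r : ℕ), 1 ≤ r → (G.closedBall x r).encard ≤ (f r : ℕ∞))
    {F : ℕ → Finset V} (hF : WeaklyConvergent (fun n => G.induce {x : V | x ∈ F n})) (t : ℝ) :
    ∃ L, Tendsto (fun n => G.meanDistribution p (F n) t) atTop (𝓝 L) := by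
  refine exists_tendsto_of_approx fun ε hε => ?_
  obtain ⟨q, hq⟩ := exists_polynomial_approx hf hball R t (half_pos hε)
  obtain ⟨c, hc⟩ := exists_tendsto_meanTrace p hball hF q
  refine ⟨_, c, hc, fun n => ?_⟩
  refine abs_integral_sub_integral_le (G.integrable_schrodingerDistribution p (F n) t)
    (G.integrable_evalTrace p (F n) q) fun ω => ?_
  have := hq (F n) (fun v => (ω v : ℝ)) (fun v => (ω v).2)
  rwa [mul_div_cancel₀ _ (two_ne_zero)] at this

/-! ### Independence of the Følner sequence. -/

/-- The sequence alternating between `F` and `F'`. -/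
def interleave {α : Type*} (F F' : ℕ → α) (n : ℕ) : α :=
  if Even n then F (n / 2) else F' (n / 2)

theorem interleave_two_mul {α : Type*} (F F' : ℕ → α) (n : ℕ) :
    interleave F F' (2 * n) = F n := by
  simp [interleave]

theorem interleave_two_mul_add_one {α : Type*} (F F' : ℕ → α) (n : ℕ) :
    interleave F F' (2 * n + 1) = F' n := by
  have : (2 * n + 1) / 2 = n := by omega
  simp [interleave, this]

theorem IsFolnerSequence.interleave {F F' : ℕ → Finset V} (hF : G.IsFolnerSequence F)
    (hF' : G.IsFolnerSequence F') : G.IsFolnerSequence (interleave F F') := by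
  refine ⟨fun n => ?_, ?_, ?_⟩
  · rw [SimpleGraph.interleave]
    split_ifs
    · exact hF.1 _
    · exact hF'.1 _
  · refine top_le_iff.1 (hF.2.1.symm.le.trans (iSup_le fun n => ?_))
    have := le_iSup (fun n => (⊤ : G.Subgraph).induce
      ((SimpleGraph.interleave F F' n : Finset V) : Set V)) (2 * n)
    refine le_trans (le_of_eq ?_) this
    simp only [interleave_two_mul]
  · have hdiv : Tendsto (fun n : ℕ => n / 2) atTop atTop :=
      Nat.tendsto_div_const_atTop two_ne_zero
    have h1 := (hF.2.2.comp hdiv)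
    have h2 := (hF'.2.2.comp hdiv)
    refine (h1.if' h2 (p := fun n => Even n)).congr fun n => ?_
    rw [SimpleGraph.interleave]
    split_ifs <;> rfl

/-- Along the interleaved Følner sequence the means have a limit, shared by the even and odd
subsequences. -/
theorem tendsto_meanDistribution_unique (hf : IsSubexponential f)
    (hball : ∀ (x : V) (r : ℕ), 1 ≤ r → (G.closedBall x r).encard ≤ (f r : ℕ∞))
    (hupf : G.HasUniformPatchFrequency) {F F' : ℕ → Finset V} (hF : G.IsFolnerSequence F)
    (hF' : G.IsFolnerSequence F') {t L : ℝ}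
    (hL : Tendsto (fun n => G.meanDistribution p (F n) t) atTop (𝓝 L)) :
    Tendsto (fun n => G.meanDistribution p (F' n) t) atTop (𝓝 L) := by
  obtain ⟨L', hL'⟩ := exists_tendsto_meanDistribution p hf hball (hupf _ (hF.interleave hF')) t
  have htwo : Tendsto (fun n : ℕ => 2 * n) atTop atTop :=
    tendsto_id.const_mul_atTop' two_pos
  have h1 := hL'.comp htwo
  have h2 := hL'.comp ((tendsto_add_atTop_nat 1).comp htwo)
  simp only [Function.comp_def, interleave_two_mul, interleave_two_mul_add_one] at h1 h2
  rwa [tendsto_nhds_unique hL h1]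

end SimpleGraph

/-! ### The integrated density of states. -/

theorem theorem4 {V : Type*} [Infinite V] (G : SimpleGraph V) (hconn : G.Connected)
    (f : ℕ → ℕ) (hf : IsSubexponential f)
    (hball : ∀ (x : V) (r : ℕ), 1 ≤ r → (G.closedBall x r).encard ≤ (f r : ℕ∞))
    (hupf : G.HasUniformPatchFrequency)
    (R : Finset ℝ) (p : PMF R) :
    ∃ N : ℝ → ℝ, ∀ F : ℕ → Finset V, G.IsFolnerSequence F →
      IsSubexponential (fun k => {S : Finset V | S ∈ Set.range F ∧ S.card = k}.ncard) →
      ∀ᵐ ω ∂(iidPotential V p),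
        TendstoUniformly
          (fun (n : ℕ) (t : ℝ) => G.schrodingerDistribution (F n) (fun v => (ω v : ℝ)) t)
          N atTop := by
  by_cases hex : ∃ F₀ : ℕ → Finset V, G.IsFolnerSequence F₀
  swap
  -- Without Følner sequences the claim is vacuous and any function serves.
  · exact ⟨0, fun F hF => absurd ⟨F, hF⟩ hex⟩
  obtain ⟨F₀, hF₀⟩ := hex
  choose N hN using fun t =>
    SimpleGraph.exists_tendsto_meanDistribution p hf hball (hupf F₀ hF₀) t
  refine ⟨N, fun F hF hsub => ?_⟩
  have hmean : ∀ t, Tendsto (fun n => G.meanDistribution p (F n) t) atTop (𝓝 (N t)) := fun t =>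
    SimpleGraph.tendsto_meanDistribution_unique p hf hball hupf hF₀ hF (hN t)
  have hcard : Tendsto (fun n => (F n).card) atTop atTop := by
    refine (hupf F hF).1.congr fun n => ?_
    rw [Nat.card_eq_fintype_card, SimpleGraph.card_setOf_mem]
  -- Nets for the errors `1 / (m + 1)` have a countable union, so one null set handles all their
  -- points.
  choose T hT hnet using fun m : ℕ =>
    SimpleGraph.exists_finite_net hf hball R (Nat.one_div_pos_of_nat (α := ℝ) (n := m))
  have hcount : (⋃ m, T m).Countable := Set.countable_iUnion fun m => (hT m).countable
  have hae : ∀ᵐ ω ∂(iidPotential V p), ∀ t ∈ ⋃ m, T m, Tendsto (fun n =>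
      G.schrodingerDistribution (F n) (fun v => (ω v : ℝ)) t) atTop (𝓝 (N t)) := by
    rw [ae_ball_iff hcount]
    intro t _
    filter_upwards [G.ae_tendsto_sub_meanDistribution p hcard hsub t] with ω hω
    simpa using hω.add (hmean t)
  filter_upwards [hae] with ω hω
  rw [Metric.tendstoUniformly_iff]
  intro ε hε
  obtain ⟨m, hm⟩ := exists_nat_one_div_lt (show 0 < ε / 3 by positivity)
  have hev : ∀ᶠ n in atTop, ∀ t ∈ T m,
      |G.schrodingerDistribution (F n) (fun v => (ω v : ℝ)) t - N t| < ε / 3 := by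
    rw [eventually_all_finite (hT m)]
    intro t ht
    exact (hω t (Set.mem_iUnion_of_mem m ht)).eventually (Metric.ball_mem_nhds _ (by positivity))
  filter_upwards [hev] with n hn s
  obtain ⟨t, ht, hst⟩ := hnet m s
  have h1 := hst (F n) (fun v => (ω v : ℝ)) (fun v => (ω v).2)
  -- The net estimate holds for all potentials, so it passes to means and then to their limit.
  have h2 : |N s - N t| ≤ 1 / ((m : ℝ) + 1) := by
    refine le_of_tendsto ((hmean s).sub (hmean t)).abs (Eventually.of_forall fun n => ?_)
    exact SimpleGraph.abs_integral_sub_integral_le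
      (G.integrable_schrodingerDistribution p (F n) s)
      (G.integrable_schrodingerDistribution p (F n) t)
      fun ω => hst (F n) (fun v => (ω v : ℝ)) (fun v => (ω v).2)
  have h3 := abs_lt.1 (hn t ht)
  have h1 := abs_le.1 h1
  have h2 := abs_le.1 h2
  rw [Real.dist_eq, abs_lt]
  constructor <;> linarith
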